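/- **Setting.** Let $M\ge 1$. Vectors of $\mathbb{R}^M$ carry the Euclidean norm $\|\cdot\|$, and for a real $M\times M$ matrix $Q$ let $\|Q\|_{S_\infty}$ be its largest singular value. For $r\in\{1,\dots,M\}$ put $$\mathcal{M}(\rho,r)=\{Q\in\mathbb{R}^{M\times M}:\ \operatorname{rank}(Q)\le r,\ \|Q\|_{S_\infty}\le\rho\}.$$ Let $(X_t)_{t\ge1}$ be a strictly stationary $\mathbb{R}^M$-valued process with $X_t=AX_{t-1}+\xi_t$ almost surely for $t\ge2$, where $(\xi_t)$ are i.i.d. and centered. Assume: 1. $A\in\mathcal{M}(\rho,r_0)$ for some $\rho<1$ and $r_0\in\{1,\dots,M\}$; 2. there are constants $c,d>0$ such that $\mathbb{E}\exp(|\xi_t^{(j)}|/c)\le d$ for every coordinate $j=1,\dots,M$; 3. the loss $\ell:\mathbb{R}^M\to\mathbb{R}$ is $L$-Lipschitz for the Euclidean norm, for some $L\le1$; 4. $r\in\{1,\dots,M\}$ and $n\ge 1+16\,\delta_0^2\,Mr\log(9rn)/\mathcal{V}_0$, where $$\mathcal{V}_0=\frac{8e\,c^2d\,(2-\rho)}{(1-\rho)^3},\qquad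 \delta_0=\frac{2c}{1-\rho}.$$ Let $R(Q)=\mathbb{E}[\ell(X_t-QX_{t-1})]$ for a matrix $Q$ (this is well defined and does not depend on $t\ge2$), let $R_n(Q)=\frac1{n-1}\sum_{i=2}^n\ell(X_i-QX_{i-1})$, and let the rank-$r$ empirical risk minimizer $\hat A_r$ be any minimizer of $R_n$ over $\mathcal{M}(\rho,r)$; such a minimizer exists. **Theorem 1.** The minimum of $R$ over $\mathcal{M}(\rho,r)$ is attained, and for every $\eta>0$, with probability at least $1-\eta$ (on one event of at least this probability, for all minimizers simultaneously), $$ \begin{aligned} R(\hat A_r)\ \le\ & \min_{Q\in\mathcal{M}(\rho,r)}R(Q)+4(1+\rho)\sqrt{\frac{4\mathcal{V}_0M^2r\log(9rn)}{n-1}} +2(1+\rho)\log\Big(\frac4\eta\Big)\sqrt{\frac{\mathcal{V}_0}{4(n-1)\,r\log(9rn)}}\\ &+\frac{\sqrt M}{n}\Big(\frac{3e\,dc}{1-\rho}+\frac{\mathcal{V}_0}{2\delta_0}\Big)+\frac{2\delta_0\sqrt M}{n(n-1)}\log\Big(\frac2\eta\Big). \end{aligned} $$ -/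

import Mathlib

open MeasureTheory ProbabilityTheory
open scoped NNReal ENNReal

noncomputable section

namespace LowRankVAR

/-- The matrix `Q` acting on the vectors of `ℝ^M` (with the Euclidean norm). -/
abbrev act {M : ℕ} (Q : Matrix (Fin M) (Fin M) ℝ) :
    EuclideanSpace ℝ (Fin M) →L[ℝ] EuclideanSpace ℝ (Fin M) :=
  Matrix.toEuclideanCLM (n := Fin M) (𝕜 := ℝ) Q

/-- The Schatten norm `‖Q‖_{S_∞}`: the largest singular value of `Q` (singular values are listed
in decreasing order, starting at index `0`). -/
def schattenInf {M : ℕ} (Q : Matrix (Fin M) (Fin M) ℝ) : ℝ :=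
  LinearMap.singularValues (Matrix.toEuclideanLin Q) 0

/-- The largest singular value is the operator norm for the Euclidean norm. -/
theorem schattenInf_eq_opNorm {M : ℕ} (Q : Matrix (Fin M) (Fin M) ℝ) :
    schattenInf Q = ‖act Q‖ := by
  set T := Matrix.toEuclideanLin Q with hT
  have hact : ∀ x, act Q x = T x := fun x => rfl
  have hfin : Module.finrank ℝ (EuclideanSpace ℝ (Fin M)) = M := by simp
  have hsq : ∀ x, ‖T x‖ ^ 2 = inner ℝ ((LinearMap.adjoint T ∘ₗ T) x) x := by
    intro x
    rw [LinearMap.comp_apply, LinearMap.adjoint_inner_left, real_inner_self_eq_norm_sq]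
  have h0 : 0 ≤ schattenInf Q := LinearMap.singularValues_nonneg _ _
  apply le_antisymm
  · rcases Nat.eq_zero_or_pos M with hM | hM
    · have : schattenInf Q = 0 := LinearMap.singularValues_of_finrank_le _ (by omega)
      rw [this]; positivity
    · obtain ⟨v, hv⟩ := (LinearMap.hasEigenvalue_adjoint_comp_self_sq_singularValues T
        (n := 0) (by omega)).exists_hasEigenvector
      have hv0 : 0 < ‖v‖ := norm_pos_iff.mpr hv.2
      have h1 : ‖T v‖ ^ 2 = (schattenInf Q * ‖v‖) ^ 2 := by
        rw [hsq, hv.apply_eq_smul, real_inner_smul_left, real_inner_self_eq_norm_sq, mul_pow]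
        rfl
      have h2 : schattenInf Q * ‖v‖ ≤ ‖act Q‖ * ‖v‖ := by
        rw [← (sq_eq_sq₀ (norm_nonneg _) (by positivity)).mp h1]
        exact (act Q).le_opNorm v
      exact le_of_mul_le_mul_right h2 hv0
  · refine ContinuousLinearMap.opNorm_le_bound _ h0 fun x => ?_
    have hS := T.isSymmetric_adjoint_comp_self
    let b := hS.eigenvectorBasis hfin
    have h1 : ‖T x‖ ^ 2 = ∑ i : Fin M, T.singularValues i ^ 2 * inner ℝ (b i) x ^ 2 := by
      rw [hsq, ← b.sum_inner_mul_inner]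
      refine Finset.sum_congr rfl fun i _ => ?_
      have h2 : inner ℝ ((LinearMap.adjoint T ∘ₗ T) x) (b i) =
          T.singularValues i ^ 2 * inner ℝ (b i) x := by
        rw [hS x (b i), hS.apply_eigenvectorBasis hfin, T.sq_singularValues_fin hfin,
          real_inner_comm, real_inner_smul_left]
        rfl
      rw [h2]; ring
    have h3 : ‖x‖ ^ 2 = ∑ i : Fin M, inner ℝ (b i) x ^ 2 := by
      rw [← real_inner_self_eq_norm_sq, ← b.sum_inner_mul_inner]
      refine Finset.sum_congr rfl fun i _ => ?_
      rw [real_inner_comm, sq]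
    rw [hact, ← sq_le_sq₀ (norm_nonneg _) (by positivity), mul_pow, h1, h3, Finset.mul_sum]
    refine Finset.sum_le_sum fun i _ => mul_le_mul_of_nonneg_right ?_ (sq_nonneg _)
    exact pow_le_pow_left₀ (T.singularValues_nonneg _) (T.singularValues_antitone (Nat.zero_le _)) 2

/-- The class `𝓜(ρ, r)` of the real `M × M` matrices of rank at most `r` whose largest singular
value is at most `ρ`. -/
def matClass (M : ℕ) (ρ : ℝ) (r : ℕ) : Set (Matrix (Fin M) (Fin M) ℝ) :=
  {Q | Q.rank ≤ r ∧ schattenInf Q ≤ ρ}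

/-- `(X_t)_{t ≥ 1}` is a (strictly) stationary VAR(1) process with transition matrix `A`, driven by
the i.i.d. centered noise `(ξ_t)`: `X_t = A X_{t-1} + ξ_t` almost surely for `t ≥ 2`. The value
`X 0` plays no role. -/
structure IsStationaryVAR {Ω : Type*} [MeasurableSpace Ω] (μ : Measure Ω) {M : ℕ}
    (A : Matrix (Fin M) (Fin M) ℝ) (X ξ : ℕ → Ω → EuclideanSpace ℝ (Fin M)) : Prop where
  measurable_noise : ∀ t, Measurable (ξ t)
  indep_noise : iIndepFun ξ μ
  ident_noise : ∀ s t, IdentDistrib (ξ s) (ξ t) μ μ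
  integrable_noise : ∀ t, Integrable (ξ t) μ
  centered_noise : ∀ t, ∫ ω, ξ t ω ∂μ = 0
  measurable_process : ∀ t, 1 ≤ t → Measurable (X t)
  recursion : ∀ t, 2 ≤ t → ∀ᵐ ω ∂μ, X t ω = act A (X (t - 1) ω) + ξ t ω
  stationary : ∀ h : ℕ, IdentDistrib (fun ω (t : ℕ) => X (1 + t + h) ω)
    (fun ω (t : ℕ) => X (1 + t) ω) μ μ

/-- The generalization error `R(Q) = 𝔼[ℓ(X_t - Q X_{t-1})]`, written at `t = 2`. -/
def genError {Ω : Type*} [MeasurableSpace Ω] (μ : Measure Ω) {M : ℕ}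
    (ℓ : EuclideanSpace ℝ (Fin M) → ℝ) (X : ℕ → Ω → EuclideanSpace ℝ (Fin M))
    (Q : Matrix (Fin M) (Fin M) ℝ) : ℝ :=
  ∫ ω, ℓ (X 2 ω - act Q (X 1 ω)) ∂μ

/-- The empirical error `R_n(Q) = (n-1)⁻¹ ∑_{i=2}^n ℓ(x_i - Q x_{i-1})` of `Q` on the observations
`x_1, …, x_n`. -/
def empError {M : ℕ} (n : ℕ) (ℓ : EuclideanSpace ℝ (Fin M) → ℝ)
    (x : ℕ → EuclideanSpace ℝ (Fin M)) (Q : Matrix (Fin M) (Fin M) ℝ) : ℝ :=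
  1 / ((n : ℝ) - 1) * ∑ i ∈ Finset.Icc 2 n, ℓ (x i - act Q (x (i - 1)))

/-- `Â` is a rank-`r` empirical risk minimizer (a fixed-rank estimator) for the observations
`x_1, …, x_n`: it minimizes `R_n` over `𝓜(ρ, r)`. -/
def IsFixedRankEstimator {M : ℕ} (n : ℕ) (ℓ : EuclideanSpace ℝ (Fin M) → ℝ) (ρ : ℝ) (r : ℕ)
    (x : ℕ → EuclideanSpace ℝ (Fin M)) (Â : Matrix (Fin M) (Fin M) ℝ) : Prop :=
  Â ∈ matClass M ρ r ∧ ∀ Q ∈ matClass M ρ r, empError n ℓ x Â ≤ empError n ℓ x Q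

/-- The constant `𝒱₀ = 8 e c² d (2 - ρ) / (1 - ρ)³`. -/
def V₀ (ρ c d : ℝ) : ℝ := 8 * Real.exp 1 * c ^ 2 * d * (2 - ρ) / (1 - ρ) ^ 3

/-- The constant `δ₀ = 2 c / (1 - ρ)`. -/
def δ₀ (ρ c : ℝ) : ℝ := 2 * c / (1 - ρ)

end LowRankVAR

end

/-! The minimizer is compared with an oracle `Q₀` through a finite net. For a minimizer `Q`, pick a
net point `B` close to it, pass from the risk of `B` to its empirical risk, return to the empirical
risk of `Q`, use minimality against `Q₀`, and pass to the risk of `Q₀`. The union bound runs over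
the net only; the two replacements of `Q` by `B` cost `1/n` times a mean norm, which is itself
controlled by a deviation bound. Matrices of the class factor through `ℝ^r` (`mem_matClass_iff`), so
covering two balls of dimension `M r` gives a net whose log-cardinality is at most `2 M r log(9 r
n)`.

The deviation bound is the Bernstein inequality `IsAR.measure_sum_ge_le`. For the chain started at
`0`, the innovations are integrated out from the last to the first. Since `A` contracts, the
expected cost-to-go `value` is Lipschitz uniformly in the horizon; each innovation therefore enters
through a function with Lipschitz constant at most `(α + β) / (1 - ρ)`, and
`LipBound.lintegral_exp_le` bounds its effect on the log-Laplace transform by a term quadratic in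
that constant.

Independence of the initial state from the innovations is not part of the model. It is replaced by a
coupling: stationarity moves the observation window to time `h`, where the process differs from the
chain driven by the same noise by at most `ρ^h ‖X 0‖`, and `h` tends to infinity. The factor `√M`
comes from the scale `c √M` at which the Euclidean norm of the noise has an exponential moment. -/

namespace LowRankVAR

/-! ### Covering numbers of balls in finite dimension. -/

section Cover

/-- Volumetric bound for the internal covering numbers of a ball. -/
theorem exists_finset_cover_closedBall {F : Type*} [NormedAddCommGroup F] [NormedSpace ℝ F]
    [FiniteDimensional ℝ F] {R ε : ℝ} (hR : 0 ≤ R) (hε : 0 < ε) :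
    ∃ t : Finset F, (∀ y ∈ t, ‖y‖ ≤ R) ∧ (∀ x, ‖x‖ ≤ R → ∃ y ∈ t, ‖x - y‖ ≤ ε) ∧
      (t.card : ℝ) ≤ (1 + 2 * R / ε) ^ Module.finrank ℝ F := by
  borelize F
  let μ : Measure F := Measure.addHaar
  -- Volume comparison: the balls of radius `ε / 2` around separated points are disjoint and lie in
  -- the ball of radius `R + ε / 2`.
  have sep : ∀ s : Finset F, (∀ c ∈ s, ‖c‖ ≤ R) → (∀ c ∈ s, ∀ d ∈ s, c ≠ d → ε ≤ ‖c - d‖) →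
      (s.card : ℝ) ≤ (1 + 2 * R / ε) ^ Module.finrank ℝ F := by
    intro s hs h
    have hδ : 0 < ε / 2 := by positivity
    have hρ : 0 < R + ε / 2 := by positivity
    set A := ⋃ c ∈ s, Metric.ball (c : F) (ε / 2) with hA
    have D : Set.Pairwise (s : Set F) (Function.onFun Disjoint fun c => Metric.ball (c : F) (ε / 2)) := by
      rintro c hc d hd hcd
      apply Metric.ball_disjoint_ball
      rw [dist_eq_norm]
      linarith [h c hc d hd hcd]
    have A_subset : A ⊆ Metric.ball (0 : F) (R + ε / 2) := by
      refine Set.iUnion₂_subset fun x hx => ?_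
      apply Metric.ball_subset_ball'
      rw [dist_zero_right]
      linarith [hs x hx]
    have I : (s.card : ℝ≥0∞) * ENNReal.ofReal ((ε / 2) ^ Module.finrank ℝ F) * μ (Metric.ball 0 1) ≤
        ENNReal.ofReal ((R + ε / 2) ^ Module.finrank ℝ F) * μ (Metric.ball 0 1) :=
      calc
        (s.card : ℝ≥0∞) * ENNReal.ofReal ((ε / 2) ^ Module.finrank ℝ F) * μ (Metric.ball 0 1) = μ A := by
          rw [hA, measure_biUnion_finset D fun c _ => measurableSet_ball]
          simp only [μ.addHaar_ball_of_pos _ hδ]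
          simp only [Finset.sum_const, nsmul_eq_mul, mul_assoc]
        _ ≤ μ (Metric.ball (0 : F) (R + ε / 2)) := measure_mono A_subset
        _ = ENNReal.ofReal ((R + ε / 2) ^ Module.finrank ℝ F) * μ (Metric.ball 0 1) := by
          simp only [μ.addHaar_ball_of_pos _ hρ]
    have J : (s.card : ℝ≥0∞) * ENNReal.ofReal ((ε / 2) ^ Module.finrank ℝ F) ≤
        ENNReal.ofReal ((R + ε / 2) ^ Module.finrank ℝ F) :=
      (ENNReal.mul_le_mul_iff_left (Metric.measure_ball_pos _ _ zero_lt_one).ne' measure_ball_lt_top.ne).1 I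
    have K := ENNReal.toReal_le_of_le_ofReal (pow_nonneg hρ.le _) J
    rw [ENNReal.toReal_mul, ENNReal.toReal_natCast, ENNReal.toReal_ofReal (by positivity)] at K
    have hq : (1 + 2 * R / ε) = (R + ε / 2) / (ε / 2) := by field_simp; ring
    rw [hq, div_pow, le_div_iff₀ (by positivity)]
    exact K
  obtain ⟨B, hB⟩ := exists_nat_ge ((1 + 2 * R / ε) ^ Module.finrank ℝ F)
  lift ε to ℝ≥0 using hε.le
  have lt_of_edist : ∀ {c d : F}, (ε : ℝ≥0∞) < edist c d → (ε : ℝ) ≤ ‖c - d‖ := fun {c d} h1 => by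
    rw [edist_dist, dist_eq_norm, ENNReal.coe_nnreal_eq] at h1
    exact ((ENNReal.ofReal_lt_ofReal_iff_of_nonneg ε.2).1 h1).le
  -- The packing number has to be finite for the maximal separated set to be a cover. Were it above
  -- `B`, some separated set would contain `B + 1` points, against `sep`.
  have hpack : Metric.packingNumber ε (Metric.closedBall (0 : F) R) ≤ B := by
    refine iSup₂_le fun C hC => iSup_le fun hs => ?_
    by_contra hlt
    rw [not_le] at hlt
    obtain ⟨t, ht, htc⟩ := Set.exists_subset_encard_eq (Order.add_one_le_of_lt hlt)
    have htf : t.Finite := Set.finite_of_encard_eq_coe (k := B + 1) (by simpa using htc)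
    have := sep htf.toFinset (fun c hc => by simpa using hC (ht (by simpa using hc)))
      (fun c hc d hd hcd => by
        have h1 := hs (ht (by simpa using hc)) (ht (by simpa using hd)) hcd
        exact lt_of_edist h1)
    have h2 : (htf.toFinset.card : ℕ∞) = B + 1 := by
      rw [← htc, htf.encard_eq_coe_toFinset_card]
    have h3 : htf.toFinset.card = B + 1 := by exact_mod_cast h2
    rw [h3] at this
    push_cast at this
    linarith
  have hne : Metric.packingNumber ε (Metric.closedBall (0 : F) R) ≠ ⊤ :=
    (hpack.trans_lt (ENat.natCast_lt_top B)).ne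
  have hfin : (Metric.maximalSeparatedSet ε (Metric.closedBall (0 : F) R)).Finite := by
    rw [← Set.encard_ne_top_iff, Metric.encard_maximalSeparatedSet hne]
    exact hne
  have hmem : ∀ y ∈ hfin.toFinset, ‖y‖ ≤ R := fun y hy => by
    simpa using Metric.maximalSeparatedSet_subset (hfin.mem_toFinset.1 hy)
  refine ⟨hfin.toFinset, hmem, fun x hx => ?_, sep _ hmem fun c hc d hd hcd => ?_⟩
  · obtain ⟨y, hy, hxy⟩ := Metric.isCover_maximalSeparatedSet hne (by simpa using hx : x ∈ Metric.closedBall (0 : F) R)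
    refine ⟨y, by simpa using hy, ?_⟩
    have h1 : edist x y ≤ ε := hxy
    rw [edist_dist, dist_eq_norm, ENNReal.coe_nnreal_eq] at h1
    exact (ENNReal.ofReal_le_ofReal_iff ε.2).1 h1
  · have h1 := Metric.isSeparated_maximalSeparatedSet (by simpa using hc) (by simpa using hd) hcd
    exact lt_of_edist h1

end Cover

/-! ### From sub-exponential coordinates to the Euclidean norm. -/

section ExpMoment

/-- The series of `cosh` has even powers only, and those of `‖z‖ / √M` are powers of the arithmetic
mean of the `|z j| ^ 2`; the power-mean inequality then applies term by term. -/
theorem cosh_norm_div_sqrt_le {M : ℕ} (hM : 1 ≤ M) (z : EuclideanSpace ℝ (Fin M)) :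
    Real.cosh (‖z‖ / √M) ≤ ∑ j, (1 / (M : ℝ)) * Real.cosh |z j| := by
  have hM' : (0 : ℝ) < M := by exact_mod_cast hM
  refine hasSum_le (fun k => ?_) (Real.hasSum_cosh _)
    (hasSum_sum fun j _ => (Real.hasSum_cosh |z j|).mul_left (1 / (M : ℝ)))
  have h1 : (‖z‖ / √M) ^ 2 = ∑ j, (1 / (M : ℝ)) * |z j| ^ 2 := by
    rw [div_pow, Real.sq_sqrt hM'.le, EuclideanSpace.norm_sq_eq, ← Finset.mul_sum]
    simp only [Real.norm_eq_abs]
    ring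
  have h2 := Real.pow_arith_mean_le_arith_mean_pow Finset.univ (fun _ : Fin M => 1 / (M : ℝ))
    (fun j => |z j| ^ 2) (fun _ _ => by positivity) (by simp [hM'.ne']) (fun _ _ => by positivity) k
  rw [pow_mul, h1]
  calc _ ≤ (∑ j, 1 / (M : ℝ) * (|z j| ^ 2) ^ k) / ((2 * k).factorial : ℝ) := by gcongr
    _ = _ := by
      rw [Finset.sum_div]
      exact Finset.sum_congr rfl fun j _ => by rw [← pow_mul, mul_div_assoc]

/-- The factor `2` is the price of replacing `exp` by `cosh` on the left, from `exp x ≤ 2 cosh x`;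
on the right `cosh x ≤ exp x` for `x ≥ 0` is free. -/
theorem exp_norm_div_sqrt_le {M : ℕ} (hM : 1 ≤ M) {c : ℝ} (hc : 0 < c)
    (z : EuclideanSpace ℝ (Fin M)) :
    Real.exp (‖z‖ / (c * √M)) ≤ 2 * ∑ j, (1 / (M : ℝ)) * Real.exp (|z j| / c) := by
  have h := cosh_norm_div_sqrt_le hM (c⁻¹ • z)
  have hle : ∀ x : ℝ, 0 ≤ x → Real.cosh x ≤ Real.exp x := fun x hx => by
    rw [Real.cosh_eq]
    have := Real.exp_le_exp.2 (by linarith : -x ≤ x)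
    linarith
  have h1 : ‖c⁻¹ • z‖ / √M = ‖z‖ / (c * √M) := by
    rw [norm_smul, Real.norm_of_nonneg (by positivity)]
    field_simp
  rw [h1, Real.cosh_eq] at h
  have h2 : ∑ j, (1 / (M : ℝ)) * Real.cosh |(c⁻¹ • z) j| ≤
      ∑ j, (1 / (M : ℝ)) * Real.exp (|z j| / c) := by
    gcongr with j
    refine (hle _ (abs_nonneg _)).trans_eq ?_
    rw [PiLp.smul_apply, smul_eq_mul, abs_mul, abs_of_pos (inv_pos.2 hc)]
    ring_nf
  have := Real.exp_pos (-(‖z‖ / (c * √M)))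
  linarith

/-- Sub-exponential coordinates give an exponential moment of the Euclidean norm. -/
theorem integrable_exp_norm_div_sqrt {Ω : Type*} [MeasurableSpace Ω] {μ : Measure Ω} {M : ℕ} (hM : 1 ≤ M)
    {c d : ℝ} (hc : 0 < c) {Z : Ω → EuclideanSpace ℝ (Fin M)} (hZ : Measurable Z)
    (h : ∀ j, Integrable (fun ω => Real.exp (|Z ω j| / c)) μ ∧
      ∫ ω, Real.exp (|Z ω j| / c) ∂μ ≤ d) :
    Integrable (fun ω => Real.exp (‖Z ω‖ / (c * √M))) μ ∧
      ∫ ω, Real.exp (‖Z ω‖ / (c * √M)) ∂μ ≤ 2 * d := by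
  have hM' : (0 : ℝ) < M := by exact_mod_cast hM
  have hI : Integrable (fun ω => 2 * ∑ j, (1 / (M : ℝ)) * Real.exp (|Z ω j| / c)) μ :=
    (integrable_finsetSum _ fun j _ => (h j).1.const_mul _).const_mul _
  have h1 : Integrable (fun ω => Real.exp (‖Z ω‖ / (c * √M))) μ := by
    refine hI.mono' (by fun_prop) (.of_forall fun ω => ?_)
    rw [Real.norm_of_nonneg (Real.exp_nonneg _)]
    exact exp_norm_div_sqrt_le hM hc _
  refine ⟨h1, (integral_mono h1 hI fun ω => exp_norm_div_sqrt_le hM hc _).trans ?_⟩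
  rw [integral_const_mul, integral_finsetSum _ fun j _ => (h j).1.const_mul _]
  gcongr
  calc _ ≤ ∑ j : Fin M, (1 / (M : ℝ)) * d := by
        refine Finset.sum_le_sum fun j _ => ?_
        rw [integral_const_mul]
        exact mul_le_mul_of_nonneg_left (h j).2 (by positivity)
    _ = d := by simp [hM'.ne']

end ExpMoment

end LowRankVAR

namespace LowRankVAR

/-! ### Laplace transform of a Lipschitz function of one innovation. -/

section Step

theorem hasSum_exp_sub_one_sub (x : ℝ) :
    HasSum (fun n : ℕ => x ^ (n + 2) / (n + 2).factorial) (Real.exp x - 1 - x) := by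
  have h := NormedSpace.expSeries_div_hasSum_exp (𝔸 := ℝ) x
  rw [← Real.exp_eq_exp_ℝ] at h
  have h2 := (hasSum_nat_add_iff' 2).2 h
  simpa [Finset.sum_range_succ, sub_sub] using h2

/-- The series starts at order two, so `b ^ 2` factors out of every term when `b ≤ 1`. This produces
the quadratic dependence on the Lipschitz constant. -/
theorem exp_sub_one_sub_mul_le {b x : ℝ} (hb : 0 ≤ b) (hb1 : b ≤ 1) (hx : 0 ≤ x) :
    Real.exp (b * x) - 1 - b * x ≤ b ^ 2 * (Real.exp x - 1 - x) := by
  refine hasSum_le (fun n => ?_) (hasSum_exp_sub_one_sub (b * x))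
    ((hasSum_exp_sub_one_sub x).mul_left (b ^ 2))
  rw [← mul_div_assoc]
  gcongr
  rw [mul_pow, pow_add b]
  have := pow_le_one₀ hb hb1 (n := n)
  calc b ^ n * b ^ 2 * x ^ (n + 2) ≤ 1 * b ^ 2 * x ^ (n + 2) := by gcongr
    _ = _ := by ring

/-- For `y < 0` this is `sinh y ≤ y`. -/
theorem exp_le_one_add_add_exp_abs (y : ℝ) :
    Real.exp y ≤ 1 + y + (Real.exp |y| - 1 - |y|) := by
  rcases le_or_gt 0 y with h | h
  · rw [abs_of_nonneg h]; linarith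
  · rw [abs_of_neg h]
    have h1 : Real.sinh y ≤ y := by
      have := Real.self_le_sinh_iff.2 (by linarith : 0 ≤ -y)
      rw [Real.sinh_neg] at this; linarith
    rw [Real.sinh_eq] at h1
    linarith

theorem exp_sub_one_sub_mono {x y : ℝ} (hx : 0 ≤ x) (hxy : x ≤ y) :
    Real.exp x - 1 - x ≤ Real.exp y - 1 - y :=
  hasSum_le (fun n => by gcongr) (hasSum_exp_sub_one_sub x) (hasSum_exp_sub_one_sub y)

theorem exp_half_add_le (p q : ℝ) :
    Real.exp ((p + q) / 2) ≤ (Real.exp p + Real.exp q) / 2 := by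
  have h := convexOn_exp.2 (Set.mem_univ p) (Set.mem_univ q) (by norm_num : (0 : ℝ) ≤ 1 / 2)
    (by norm_num : (0 : ℝ) ≤ 1 / 2) (by norm_num)
  simp only [smul_eq_mul] at h
  calc Real.exp ((p + q) / 2) = Real.exp (1 / 2 * p + 1 / 2 * q) := by ring_nf
    _ ≤ _ := by linarith

/-- The function is Lipschitz with the real constant `K`. -/
def LipBound {E : Type*} [NormedAddCommGroup E] (K : ℝ) (g : E → ℝ) : Prop := ∀ x y, |g x - g y| ≤ K * ‖x - y‖

theorem LipBound.continuous {E : Type*} [NormedAddCommGroup E] {K : ℝ} {g : E → ℝ} (h : LipBound K g) : Continuous g := by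
  refine (LipschitzWith.of_dist_le_mul (K := K.toNNReal) fun x y => ?_).continuous
  rw [Real.dist_eq, dist_eq_norm]
  exact (h x y).trans (by gcongr; exact Real.le_coe_toNNReal K)

variable {E : Type*} [NormedAddCommGroup E] [MeasurableSpace E] [BorelSpace E]

/-- The norm has an exponential moment at scale `a`, bounded by `D`. -/
def HasExpMoment (ν : Measure E) (a D : ℝ) : Prop :=
  Integrable (fun z => Real.exp (‖z‖ / a)) ν ∧ ∫ z, Real.exp (‖z‖ / a) ∂ν ≤ D

variable {ν : Measure E} {a D : ℝ}

theorem HasExpMoment.integrable_norm (h : HasExpMoment ν a D) (ha : 0 < a) :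
    Integrable (fun z => ‖z‖) ν := by
  refine (h.1.const_mul a).mono' (by fun_prop) (.of_forall fun z => ?_)
  rw [norm_norm]
  have := Real.add_one_le_exp (‖z‖ / a)
  calc ‖z‖ = a * (‖z‖ / a) := by field_simp
    _ ≤ _ := by gcongr; linarith

theorem HasExpMoment.integral_norm_le (h : HasExpMoment ν a D) (ha : 0 < a) :
    ∫ z, ‖z‖ ∂ν ≤ a * D := by
  refine (integral_mono (h.integrable_norm ha) (h.1.const_mul a) fun z => ?_).trans ?_
  · have := Real.add_one_le_exp (‖z‖ / a)
    calc ‖z‖ = a * (‖z‖ / a) := by field_simp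
      _ ≤ _ := by gcongr; linarith
  · rw [integral_const_mul]
    exact mul_le_mul_of_nonneg_left h.2 ha.le

theorem LipBound.integrable [IsProbabilityMeasure ν] {K : ℝ} {g : E → ℝ} (hg : LipBound K g)
    (hint : Integrable (fun z => ‖z‖) ν) : Integrable g ν := by
  refine ((hint.const_mul K).add (integrable_const |g 0|)).mono'
    hg.continuous.measurable.aestronglyMeasurable (.of_forall fun z => ?_)
  have h1 := hg z 0
  rw [sub_zero] at h1
  have h2 : |g z| - |g 0| ≤ |g z - g 0| := abs_sub_abs_le_abs_sub _ _
  rw [Real.norm_eq_abs, Pi.add_apply]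
  linarith

/-- The Laplace transform of a Lipschitz function of a variable with an exponential moment. -/
theorem LipBound.lintegral_exp_le [IsProbabilityMeasure ν] (hν : HasExpMoment ν a D) (ha : 0 < a)
    {K : ℝ} (hK : 0 ≤ K) (hKa : 2 * K * a ≤ 1) {g : E → ℝ} (hg : LipBound K g) :
    ∫⁻ z, ENNReal.ofReal (Real.exp (g z)) ∂ν ≤
      ENNReal.ofReal (Real.exp (∫ z, g z ∂ν + 4 * a ^ 2 * D * K ^ 2)) := by
  have hn := hν.integrable_norm ha
  have hgi := hg.integrable hn
  set m := ∫ z, g z ∂ν with hm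
  set w := ∫ z, ‖z‖ ∂ν with hw
  have hw0 : 0 ≤ w := integral_nonneg fun z => norm_nonneg z
  -- Taking `b = 2 K a ≤ 1` extracts `K ^ 2` while the exponential stays at the integrable scale
  -- `a`.
  have hexp : ∀ z : E, Real.exp (2 * K * ‖z‖) - 1 - 2 * K * ‖z‖ ≤
      (2 * K * a) ^ 2 * Real.exp (‖z‖ / a) := fun z => by
    have h1 := exp_sub_one_sub_mul_le (b := 2 * K * a) (x := ‖z‖ / a) (by positivity) hKa
      (by positivity)
    have h2 : 2 * K * a * (‖z‖ / a) = 2 * K * ‖z‖ := by field_simp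
    rw [h2] at h1
    refine h1.trans ?_
    gcongr
    have : 0 ≤ ‖z‖ / a := by positivity
    linarith
  have hI : Integrable (fun z => Real.exp (2 * K * ‖z‖) - 1 - 2 * K * ‖z‖) ν := by
    refine (hν.1.const_mul ((2 * K * a) ^ 2)).mono' (by fun_prop) (.of_forall fun z => ?_)
    rw [Real.norm_of_nonneg]
    · exact hexp z
    · have := Real.add_one_le_exp (2 * K * ‖z‖); linarith
  have hIe : Integrable (fun z => Real.exp (2 * K * ‖z‖)) ν := by
    refine ((hI.add (integrable_const (1 : ℝ))).add (hn.const_mul (2 * K))).congr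
      (.of_forall fun z => ?_)
    simp only [Pi.add_apply]; ring
  set Φ := ∫ z, (Real.exp (2 * K * ‖z‖) - 1 - 2 * K * ‖z‖) ∂ν with hΦ
  have hΦD : Φ ≤ 4 * a ^ 2 * D * K ^ 2 := by
    refine (integral_mono hI (hν.1.const_mul _) hexp).trans ?_
    rw [integral_const_mul]
    calc _ ≤ (2 * K * a) ^ 2 * D := by gcongr; exact hν.2
      _ = _ := by ring
  -- Jensen: the mean norm `w` obeys the bound already found for the random norm.
  have hJ : Real.exp (2 * K * w) - 1 - 2 * K * w ≤ Φ := by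
    have h1 : Real.exp (2 * K * w) ≤ ∫ z, Real.exp (2 * K * ‖z‖) ∂ν := by
      have := convexOn_exp.map_integral_le (μ := ν) (f := fun z => 2 * K * ‖z‖)
        Real.continuous_exp.continuousOn isClosed_univ (by simp) (hn.const_mul _) hIe
      rwa [integral_const_mul] at this
    have h2 : Φ = ∫ z, Real.exp (2 * K * ‖z‖) ∂ν - 1 - 2 * K * w := by
      have hI1 : Integrable (fun z => Real.exp (2 * K * ‖z‖) - 1) ν := hIe.sub (integrable_const _)
      rw [hΦ, integral_sub hI1 (hn.const_mul _),
        integral_sub hIe (integrable_const _), integral_const_mul]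
      simp [hw]
    linarith
  have hdev : ∀ z, |g z - m| ≤ K * ‖z‖ + K * w := fun z => by
    have h1 : g z - m = ∫ y, (g z - g y) ∂ν := by
      rw [integral_sub (integrable_const _) hgi]; simp [hm]
    rw [h1]
    calc |∫ y, (g z - g y) ∂ν| ≤ ∫ y, |g z - g y| ∂ν := abs_integral_le_integral_abs
      _ ≤ ∫ y, (K * ‖z‖ + K * ‖y‖) ∂ν := by
        refine integral_mono ((integrable_const _).sub hgi).abs
          ((integrable_const _).add (hn.const_mul _)) fun y => ?_
        refine (hg z y).trans ?_
        rw [← mul_add]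
        gcongr
        exact norm_sub_le _ _
      _ = _ := by
        rw [integral_add (integrable_const _) (hn.const_mul _), integral_const, integral_const_mul]
        simp [hw]
  -- Convexity separates `‖z‖` from `w` at the price of doubling `K`, hence the hypothesis `2 K a ≤
  -- 1`. The linear term `g z - m` integrates to zero, leaving a second-order remainder.
  have hpt : ∀ z, Real.exp (g z - m) ≤ 1 + (g z - m) +
      ((Real.exp (2 * K * ‖z‖) - 1 - 2 * K * ‖z‖) + (Real.exp (2 * K * w) - 1 - 2 * K * w)) / 2 := by
    intro z
    have h1 := exp_le_one_add_add_exp_abs (g z - m)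
    have h2 := exp_sub_one_sub_mono (abs_nonneg _) (hdev z)
    have h3 := exp_half_add_le (2 * K * ‖z‖) (2 * K * w)
    have h4 : (2 * K * ‖z‖ + 2 * K * w) / 2 = K * ‖z‖ + K * w := by ring
    rw [h4] at h3
    linarith
  have hR1 : Integrable (fun z => g z - m) ν := hgi.sub (integrable_const _)
  have hR2 : Integrable (fun z => 1 + (g z - m)) ν := (integrable_const _).add hR1
  have hR3 : Integrable (fun z => (Real.exp (2 * K * ‖z‖) - 1 - 2 * K * ‖z‖) +
      (Real.exp (2 * K * w) - 1 - 2 * K * w)) ν := hI.add (integrable_const _)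
  have hR : Integrable (fun z => 1 + (g z - m) + ((Real.exp (2 * K * ‖z‖) - 1 - 2 * K * ‖z‖) +
      (Real.exp (2 * K * w) - 1 - 2 * K * w)) / 2) ν :=
    hR2.add (hR3.div_const _)
  have hE : Integrable (fun z => Real.exp (g z - m)) ν :=
    hR.mono' ((hg.continuous.measurable.sub_const m).exp.aestronglyMeasurable)
      (.of_forall fun z => by rw [Real.norm_of_nonneg (Real.exp_nonneg _)]; exact hpt z)
  have hmain : ∫ z, Real.exp (g z - m) ∂ν ≤ Real.exp (4 * a ^ 2 * D * K ^ 2) := by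
    refine (integral_mono hE hR hpt).trans ?_
    rw [integral_add hR2 (hR3.div_const _), integral_add (integrable_const _) hR1, integral_sub hgi (integrable_const _), integral_div,
      integral_add hI (integrable_const _)]
    simp only [integral_const, probReal_univ, smul_eq_mul, one_mul]
    have := Real.add_one_le_exp (4 * a ^ 2 * D * K ^ 2)
    linarith
  have hsplit : ∀ z, Real.exp (g z) = Real.exp m * Real.exp (g z - m) := fun z => by
    rw [← Real.exp_add]; ring_nf
  simp_rw [hsplit]
  rw [← ofReal_integral_eq_lintegral_ofReal (hE.const_mul _)
    (.of_forall fun z => by positivity), integral_const_mul, Real.exp_add]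
  gcongr

end Step

end LowRankVAR

namespace LowRankVAR

/-! ### Laplace transform of additive functionals of the chain started at the origin. -/

section Chain

set_option linter.unusedSectionVars false

/-- The cost is Lipschitz with constant `α` in its first and `β` in its second argument. -/
def LipCost {E : Type*} [NormedAddCommGroup E] (α β : ℝ) (φ : E → E → ℝ) : Prop :=
  ∀ x y x' y', |φ x y - φ x' y'| ≤ α * ‖x - x'‖ + β * ‖y - y'‖

theorem LipBound.mono {E : Type*} [NormedAddCommGroup E] {K K' : ℝ} {g : E → ℝ} (h : LipBound K g)
    (hK : K ≤ K') : LipBound K' g :=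
  fun x y => (h x y).trans (by gcongr)

theorem LipCost.continuous {E : Type*} [NormedAddCommGroup E] {α β : ℝ} {φ : E → E → ℝ}
    (h : LipCost α β φ) : Continuous fun p : E × E => φ p.1 p.2 := by
  refine (LipschitzWith.of_dist_le_mul (K := α.toNNReal + β.toNNReal) fun x y => ?_).continuous
  rw [Real.dist_eq, dist_eq_norm]
  refine (h x.1 x.2 y.1 y.2).trans ?_
  rw [NNReal.coe_add, add_mul]
  gcongr
  · exact Real.le_coe_toNNReal α
  · exact norm_fst_le (x - y)
  · exact Real.le_coe_toNNReal β
  · exact norm_snd_le (x - y)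

theorem LipCost.add_right {E : Type*} [NormedAddCommGroup E] {α β L : ℝ} {φ : E → E → ℝ}
    {g : E → ℝ} (h : LipCost α β φ) (hg : LipBound L g) :
    LipCost α (β + L) fun x y => φ x y + g y := fun x y x' y' => by
  have h1 := h x y x' y'
  have h2 := hg y y'
  have h3 := abs_add_le (φ x y - φ x' y') (g y - g y')
  rw [show φ x y + g y - (φ x' y' + g y') = φ x y - φ x' y' + (g y - g y') by ring]
  linarith

theorem LipBound.lipCost {E : Type*} [NormedAddCommGroup E] {L : ℝ} {g : E → ℝ}
    (hg : LipBound L g) : LipCost 0 L fun _ y => g y := fun x y x' y' => by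
  simpa using hg y y'

variable {Ω : Type*} [MeasurableSpace Ω] {μ : Measure Ω} [IsProbabilityMeasure μ]

theorem lintegral_comp_of_indepFun {α β : Type*} [MeasurableSpace α] [MeasurableSpace β]
    {U : Ω → α} {Z : Ω → β} (hU : Measurable U) (hZ : Measurable Z) (h : IndepFun U Z μ)
    {f : α → β → ℝ≥0∞} (hf : Measurable fun p : α × β => f p.1 p.2) :
    ∫⁻ ω, f (U ω) (Z ω) ∂μ = ∫⁻ ω, ∫⁻ z, f (U ω) z ∂(μ.map Z) ∂μ := by
  have : IsProbabilityMeasure (μ.map Z) := Measure.isProbabilityMeasure_map hZ.aemeasurable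
  have h1 := h.map_prod_eq_prod_map_map hU.aemeasurable hZ.aemeasurable
  calc ∫⁻ ω, f (U ω) (Z ω) ∂μ = ∫⁻ p, f p.1 p.2 ∂(μ.map fun ω => (U ω, Z ω)) :=
        (lintegral_map hf (hU.prodMk hZ)).symm
    _ = ∫⁻ u, ∫⁻ z, f u z ∂(μ.map Z) ∂(μ.map U) := by
        rw [h1, lintegral_prod _ hf.aemeasurable]
    _ = _ := lintegral_map (Measurable.lintegral_prod_right' hf) hU

theorem integral_comp_of_indepFun {α β : Type*} [MeasurableSpace α] [MeasurableSpace β]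
    {U : Ω → α} {Z : Ω → β} (hU : Measurable U) (hZ : Measurable Z) (h : IndepFun U Z μ)
    {f : α → β → ℝ} (hf : Measurable fun p : α × β => f p.1 p.2)
    (hi : Integrable (fun ω => f (U ω) (Z ω)) μ) :
    ∫ ω, f (U ω) (Z ω) ∂μ = ∫ ω, ∫ z, f (U ω) z ∂(μ.map Z) ∂μ := by
  have : IsProbabilityMeasure (μ.map Z) := Measure.isProbabilityMeasure_map hZ.aemeasurable
  have h1 := h.map_prod_eq_prod_map_map hU.aemeasurable hZ.aemeasurable
  have h2 : Integrable (fun p : α × β => f p.1 p.2) (μ.map fun ω => (U ω, Z ω)) :=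
    (integrable_map_measure hf.aestronglyMeasurable (hU.prodMk hZ).aemeasurable).2 hi
  calc ∫ ω, f (U ω) (Z ω) ∂μ = ∫ p, f p.1 p.2 ∂(μ.map fun ω => (U ω, Z ω)) :=
        (integral_map (hU.prodMk hZ).aemeasurable hf.aestronglyMeasurable).symm
    _ = ∫ u, ∫ z, f u z ∂(μ.map Z) ∂(μ.map U) := by
        rw [h1] at h2 ⊢
        exact integral_prod _ h2
    _ = _ := integral_map hU.aemeasurable
        hf.stronglyMeasurable.integral_prod_right.aestronglyMeasurable

variable {E : Type*} [NormedAddCommGroup E] [NormedSpace ℝ E] [MeasurableSpace E] [BorelSpace E]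
  [SecondCountableTopology E]

/-- `ζ` is an i.i.d. sequence with law `ν`. -/
structure IsNoise (μ : Measure Ω) (ν : Measure E) (ζ : ℕ → Ω → E) : Prop where
  measurable : ∀ k, Measurable (ζ k)
  indep : iIndepFun ζ μ
  law : ∀ k, μ.map (ζ k) = ν

/-- The autoregressive chain started at the origin. -/
def chain (A : E →L[ℝ] E) (ζ : ℕ → Ω → E) : ℕ → Ω → E
  | 0 => fun _ => 0
  | k + 1 => fun ω => A (chain A ζ k ω) + ζ k ω

/-- The information carried by the first `k` innovations. -/
abbrev past (ζ : ℕ → Ω → E) (k : ℕ) : MeasurableSpace Ω :=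
  ⨆ i ∈ Set.Iio k, MeasurableSpace.comap (ζ i) inferInstance

/-- One transition of the chain, applied to a cost depending on two consecutive states. -/
noncomputable def push (ν : Measure E) (A : E →L[ℝ] E) (ψ : E → E → ℝ) (x : E) : ℝ :=
  ∫ z, ψ x (A x + z) ∂ν

/-- The expected total cost of `j` transitions from a given state. -/
noncomputable def value (ν : Measure E) (A : E →L[ℝ] E) (φ : E → E → ℝ) : ℕ → E → ℝ
  | 0 => fun _ => 0
  | j + 1 => push ν A fun x y => φ x y + value ν A φ j y

variable {ν : Measure E} [IsProbabilityMeasure ν] {ζ : ℕ → Ω → E} {A : E →L[ℝ] E} {a D ρ : ℝ}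

theorem IsNoise.past_le (h : IsNoise μ ν ζ) (k : ℕ) : past ζ k ≤ ‹MeasurableSpace Ω› :=
  iSup₂_le fun i _ => (h.measurable i).comap_le

theorem past_mono {k l : ℕ} (hkl : k ≤ l) : past ζ k ≤ past ζ l :=
  biSup_mono fun _ hi => lt_of_lt_of_le hi hkl

theorem measurable_past_noise (k : ℕ) : Measurable[past ζ (k + 1)] (ζ k) :=
  (comap_measurable (ζ k)).mono
    (le_iSup₂_of_le (f := fun i (_ : i ∈ Set.Iio (k + 1)) => MeasurableSpace.comap (ζ i) inferInstance)
      k (Nat.lt_succ_self k) le_rfl) le_rfl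

theorem measurable_past_chain (k : ℕ) : Measurable[past ζ k] (chain A ζ k) := by
  induction k with
  | zero => exact measurable_const
  | succ k ih =>
    exact (A.continuous.measurable.comp (ih.mono (past_mono k.le_succ) le_rfl)).add
      (measurable_past_noise k)

theorem IsNoise.measurable_chain (h : IsNoise μ ν ζ) (k : ℕ) : Measurable (chain A ζ k) :=
  (measurable_past_chain k).mono (h.past_le k) le_rfl

theorem IsNoise.indepFun_past (h : IsNoise μ ν ζ) {α : Type*} [MeasurableSpace α] {k : ℕ}
    {W : Ω → α} (hW : Measurable[past ζ k] W) : IndepFun W (ζ k) μ := by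
  have h1 := indep_iSup_of_disjoint (S := Set.Iio k) (T := {k})
    (fun i => (h.measurable i).comap_le) h.indep (by simp)
  simp only [Set.mem_singleton_iff, iSup_iSup_eq_left] at h1
  exact indep_of_indep_of_le_left h1 hW.comap_le

theorem LipCost.lipBound_right {α β : ℝ} {ψ : E → E → ℝ} (h : LipCost α β ψ) (x : E) :
    LipBound β fun z => ψ x (A x + z) := fun z z' => by
  simpa using h x (A x + z) x (A x + z')

/-- Two starting points are run with the same innovation, which cancels: the first argument
contributes `α`, the second is contracted by `A` and contributes `ρ β`. -/
theorem LipCost.lipBound_push {α β : ℝ} {ψ : E → E → ℝ} (h : LipCost α β ψ) (hβ : 0 ≤ β)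
    (hA : ‖A‖ ≤ ρ) (hn : Integrable (fun z => ‖z‖) ν) : LipBound (α + ρ * β) (push ν A ψ) := by
  intro x x'
  have hi := fun x => (h.lipBound_right (A := A) x).integrable hn
  rw [push, push, ← integral_sub (hi x) (hi x')]
  refine abs_integral_le_integral_abs.trans ?_
  have h1 : ∀ z, |ψ x (A x + z) - ψ x' (A x' + z)| ≤ (α + ρ * β) * ‖x - x'‖ := fun z => by
    refine (h _ _ _ _).trans ?_
    rw [add_sub_add_right_eq_sub, ← map_sub]
    have : ‖A (x - x')‖ ≤ ρ * ‖x - x'‖ := A.le_of_opNorm_le hA _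
    nlinarith
  refine (integral_mono ((hi x).sub (hi x')).abs (integrable_const _) h1).trans ?_
  simp

/-- The constant is the fixed point of `K = α + ρ (β + K)`, so it does not grow with the horizon. -/
theorem lipBound_value {α β : ℝ} {φ : E → E → ℝ} (h : LipCost α β φ) (hα : 0 ≤ α) (hβ : 0 ≤ β)
    (hA : ‖A‖ ≤ ρ) (hρ0 : 0 ≤ ρ) (hρ : ρ < 1) (hn : Integrable (fun z => ‖z‖) ν) (j : ℕ) :
    LipBound ((α + ρ * β) / (1 - ρ)) (value ν A φ j) := by
  have h0 : 0 < 1 - ρ := by linarith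
  induction j with
  | zero => intro x y; simp only [value, sub_self, abs_zero]; positivity
  | succ j ih =>
    refine ((h.add_right ih).lipBound_push (by positivity) hA hn).mono (le_of_eq ?_)
    field_simp
    ring

theorem IsNoise.integrable_norm_chain (h : IsNoise μ ν ζ) (hn : Integrable (fun z => ‖z‖) ν)
    (k : ℕ) : Integrable (fun ω => ‖chain A ζ k ω‖) μ := by
  induction k with
  | zero => simp [chain]
  | succ k ih =>
    have h1 : Integrable (fun ω => ‖ζ k ω‖) μ := by
      rw [← h.law k] at hn
      exact (integrable_map_measure (by fun_prop) (h.measurable k).aemeasurable).1 hn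
    refine ((ih.const_mul ‖A‖).add h1).mono' (h.measurable_chain _).norm.aestronglyMeasurable
      (.of_forall fun ω => ?_)
    rw [norm_norm]
    exact (norm_add_le _ _).trans (add_le_add_left (A.le_opNorm _) _)

theorem LipCost.integrable_comp {α β : ℝ} {ψ : E → E → ℝ} (h : LipCost α β ψ)
    {U V : Ω → E} (hU : Measurable U) (hV : Measurable V) (hUi : Integrable (fun ω => ‖U ω‖) μ)
    (hVi : Integrable (fun ω => ‖V ω‖) μ) : Integrable (fun ω => ψ (U ω) (V ω)) μ := by
  refine (((hUi.const_mul α).add (hVi.const_mul β)).add (integrable_const |ψ 0 0|)).mono'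
    (h.continuous.measurable.comp (hU.prodMk hV)).aestronglyMeasurable (.of_forall fun ω => ?_)
  have h1 := h (U ω) (V ω) 0 0
  have h2 : |ψ (U ω) (V ω)| - |ψ 0 0| ≤ |ψ (U ω) (V ω) - ψ 0 0| := abs_sub_abs_le_abs_sub _ _
  simp only [sub_zero] at h1
  simp only [Real.norm_eq_abs, Pi.add_apply]
  linarith

theorem LipCost.integrable_chain {α β : ℝ} {ψ : E → E → ℝ} (hψ : LipCost α β ψ)
    (h : IsNoise μ ν ζ) (hn : Integrable (fun z => ‖z‖) ν) (k : ℕ) :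
    Integrable (fun ω => ψ (chain A ζ k ω) (chain A ζ (k + 1) ω)) μ :=
  hψ.integrable_comp (h.measurable_chain _) (h.measurable_chain _)
    (h.integrable_norm_chain hn _) (h.integrable_norm_chain hn _)

theorem LipCost.integral_chain {α β : ℝ} {ψ : E → E → ℝ} (hψ : LipCost α β ψ)
    (h : IsNoise μ ν ζ) (hn : Integrable (fun z => ‖z‖) ν) (k : ℕ) :
    ∫ ω, ψ (chain A ζ k ω) (chain A ζ (k + 1) ω) ∂μ = ∫ ω, push ν A ψ (chain A ζ k ω) ∂μ := by
  have h1 := integral_comp_of_indepFun (h.measurable_chain (A := A) k) (h.measurable k)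
    (h.indepFun_past (measurable_past_chain k)) (f := fun x z => ψ x (A x + z))
    (hψ.continuous.measurable.comp (by fun_prop : Measurable fun p : E × E => (p.1, A p.1 + p.2)))
    (hψ.integrable_chain h hn k)
  rw [h.law k] at h1
  exact h1

/-- The innovation `ζ k` is independent of the past, so the past can be frozen and the
one-innovation Laplace bound applied inside; the mean appearing there is `push` by definition. -/
theorem LipCost.lintegral_exp_chain {α β : ℝ} {ψ : E → E → ℝ} (hψ : LipCost α β ψ)
    (h : IsNoise μ ν ζ) (hν : HasExpMoment ν a D) (ha : 0 < a) (hβ : 0 ≤ β) (hβa : 2 * β * a ≤ 1)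
    {k : ℕ} {W : Ω → ℝ} (hW : Measurable[past ζ k] W) :
    ∫⁻ ω, ENNReal.ofReal (Real.exp (W ω + ψ (chain A ζ k ω) (chain A ζ (k + 1) ω))) ∂μ ≤
      ENNReal.ofReal (Real.exp (4 * a ^ 2 * D * β ^ 2)) *
        ∫⁻ ω, ENNReal.ofReal (Real.exp (W ω + push ν A ψ (chain A ζ k ω))) ∂μ := by
  have h1 := lintegral_comp_of_indepFun
    ((hW.mono (h.past_le k) le_rfl).prodMk (h.measurable_chain (A := A) k)) (h.measurable k)
    (h.indepFun_past (hW.prodMk (measurable_past_chain k)))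
    (f := fun p z => ENNReal.ofReal (Real.exp (p.1 + ψ p.2 (A p.2 + z))))
    (((measurable_fst.comp measurable_fst).add (hψ.continuous.measurable.comp
      (by fun_prop : Measurable fun p : (ℝ × E) × E => (p.1.2, A p.1.2 + p.2)))).exp.ennreal_ofReal)
  rw [h.law k] at h1
  refine h1.trans_le ?_
  rw [← lintegral_const_mul' _ _ ENNReal.ofReal_ne_top]
  refine lintegral_mono fun ω => ?_
  have h2 := (hψ.lipBound_right (A := A) (chain A ζ k ω)).lintegral_exp_le hν ha hβ hβa
  simp only [Real.exp_add (W ω), ENNReal.ofReal_mul (Real.exp_nonneg _)]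
  rw [lintegral_const_mul' _ _ ENNReal.ofReal_ne_top, mul_left_comm]
  gcongr
  refine h2.trans_eq ?_
  rw [add_comm, Real.exp_add, ENNReal.ofReal_mul (Real.exp_nonneg _), push]

/-- The weight `W` stores costs already incurred, which lets the induction absorb the first cost
into it. Each transition adds one quadratic term to the exponent. -/
theorem lintegral_exp_sum_chain {α β : ℝ} {φ : E → E → ℝ} (hφ : LipCost α β φ)
    (h : IsNoise μ ν ζ) (hν : HasExpMoment ν a D) (ha : 0 < a) (hα : 0 ≤ α) (hβ : 0 ≤ β)
    (hA : ‖A‖ ≤ ρ) (hρ0 : 0 ≤ ρ) (hρ : ρ < 1) (hK : 2 * ((α + β) / (1 - ρ)) * a ≤ 1)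
    (j k : ℕ) {W : Ω → ℝ} (hW : Measurable[past ζ k] W) :
    ∫⁻ ω, ENNReal.ofReal (Real.exp (W ω + ∑ i ∈ Finset.range j,
        φ (chain A ζ (k + i) ω) (chain A ζ (k + i + 1) ω))) ∂μ ≤
      ENNReal.ofReal (Real.exp (j * (4 * a ^ 2 * D * ((α + β) / (1 - ρ)) ^ 2))) *
        ∫⁻ ω, ENNReal.ofReal (Real.exp (W ω + value ν A φ j (chain A ζ k ω))) ∂μ := by
  have h0 : 0 < 1 - ρ := by linarith
  have hn := hν.integrable_norm ha
  induction j generalizing k W with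
  | zero => simp [value]
  | succ j ih =>
    have hW' : Measurable[past ζ (k + 1)] fun ω =>
        W ω + φ (chain A ζ k ω) (chain A ζ (k + 1) ω) :=
      (hW.mono (past_mono k.le_succ) le_rfl).add (hφ.continuous.measurable.comp
        (((measurable_past_chain k).mono (past_mono k.le_succ) le_rfl).prodMk
          (measurable_past_chain (k + 1))))
    -- An innovation acts on the current cost (`β`) and on the cost-to-go (`(α + ρ β) / (1 - ρ)`).
    have hL : (α + β) / (1 - ρ) = β + (α + ρ * β) / (1 - ρ) := by field_simp; ring
    have h1 := ih (k + 1) hW'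
    have h2 := (hφ.add_right (lipBound_value hφ hα hβ hA hρ0 hρ hn j)).lintegral_exp_chain
      (A := A) h hν ha (by positivity) (by rw [← hL]; exact hK) hW
    rw [← hL] at h2
    calc _ = ∫⁻ ω, ENNReal.ofReal (Real.exp (W ω + φ (chain A ζ k ω) (chain A ζ (k + 1) ω) +
          ∑ i ∈ Finset.range j,
            φ (chain A ζ (k + 1 + i) ω) (chain A ζ (k + 1 + i + 1) ω))) ∂μ := by
          refine lintegral_congr fun ω => ?_
          rw [Finset.sum_range_succ', add_assoc (W ω), add_comm (φ _ _)]
          simp only [add_zero, ← add_assoc, add_right_comm k _ 1]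
      _ ≤ _ := h1
      _ ≤ _ := by
          simp only [← add_assoc] at h2
          refine (mul_le_mul_right h2 _).trans_eq ?_
          rw [← mul_assoc, ← ENNReal.ofReal_mul (Real.exp_nonneg _), ← Real.exp_add]
          congr 3
          push_cast
          ring

theorem integral_sum_chain {α β : ℝ} {φ : E → E → ℝ} (hφ : LipCost α β φ)
    (h : IsNoise μ ν ζ) (hn : Integrable (fun z => ‖z‖) ν) (hα : 0 ≤ α) (hβ : 0 ≤ β)
    (hA : ‖A‖ ≤ ρ) (hρ0 : 0 ≤ ρ) (hρ : ρ < 1) (j k : ℕ) :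
    ∫ ω, value ν A φ j (chain A ζ k ω) ∂μ =
      ∑ i ∈ Finset.range j, ∫ ω, φ (chain A ζ (k + i) ω) (chain A ζ (k + i + 1) ω) ∂μ := by
  induction j generalizing k with
  | zero => simp [value]
  | succ j ih =>
    have hv := lipBound_value hφ hα hβ hA hρ0 hρ hn j
    have h1 := (hφ.add_right hv).integral_chain (A := A) h hn k
    rw [value, ← h1, integral_add (hφ.integrable_chain h hn k)
      (hv.lipCost.integrable_chain h hn k), ih, Finset.sum_range_succ', add_comm]
    simp only [add_zero, ← add_assoc, add_right_comm k _ 1]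

/-- This handles the burn-in. Going back one step multiplies the Lipschitz constant by `ρ`, so the
quadratic terms are dominated by a geometric series and the bound is uniform in `k`. -/
theorem LipBound.lintegral_exp_chain (h : IsNoise μ ν ζ) (hν : HasExpMoment ν a D) (ha : 0 < a)
    (hD : 0 ≤ D) (hA : ‖A‖ ≤ ρ) (hρ0 : 0 ≤ ρ) (hρ : ρ < 1) {K : ℝ} (hK : 0 ≤ K)
    (hKa : 2 * K * a ≤ 1) (k : ℕ) {g : E → ℝ} (hg : LipBound K g) :
    ∫⁻ ω, ENNReal.ofReal (Real.exp (g (chain A ζ k ω))) ∂μ ≤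
      ENNReal.ofReal (Real.exp (∫ ω, g (chain A ζ k ω) ∂μ + 4 * a ^ 2 * D * K ^ 2 / (1 - ρ))) := by
  have h0 : 0 < 1 - ρ := by linarith
  have hn := hν.integrable_norm ha
  induction k generalizing g K with
  | zero =>
    simp only [chain, lintegral_const, measure_univ, mul_one, integral_const, probReal_univ,
      one_smul]
    gcongr
    have : 0 ≤ 4 * a ^ 2 * D * K ^ 2 / (1 - ρ) := by positivity
    linarith
  | succ k ih =>
    have hP := hg.lipCost.lipBound_push (ν := ν) hK hA hn
    rw [zero_add] at hP
    have h1 := hg.lipCost.lintegral_exp_chain (A := A) h hν ha hK hKa (k := k) (W := fun _ => 0)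
      measurable_const
    have h2 := ih (mul_nonneg hρ0 hK) (by nlinarith [mul_nonneg hK ha.le]) hP
    simp only [zero_add] at h1
    refine h1.trans ((mul_le_mul_right h2 _).trans ?_)
    rw [← hg.lipCost.integral_chain h hn k, ← ENNReal.ofReal_mul (Real.exp_nonneg _),
      ← Real.exp_add]
    refine ENNReal.ofReal_le_ofReal (Real.exp_le_exp.2 ?_)
    rw [add_left_comm]
    refine add_le_add_right ?_ _
    have h3 : 0 ≤ 4 * a ^ 2 * D * K ^ 2 := by positivity
    rw [← sub_nonneg]
    have : 4 * a ^ 2 * D * K ^ 2 / (1 - ρ) - (4 * a ^ 2 * D * K ^ 2 +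
        4 * a ^ 2 * D * (ρ * K) ^ 2 / (1 - ρ)) = 4 * a ^ 2 * D * K ^ 2 * ρ := by
      field_simp; ring
    rw [this]
    positivity

/-- Laplace transform of an additive functional of the chain, after a burn-in of `h` steps. -/
theorem lintegral_exp_chain_le {α β : ℝ} {φ : E → E → ℝ} (hφ : LipCost α β φ)
    (h : IsNoise μ ν ζ) (hν : HasExpMoment ν a D) (ha : 0 < a) (hD : 0 ≤ D) (hα : 0 ≤ α)
    (hβ : 0 ≤ β) (hA : ‖A‖ ≤ ρ) (hρ0 : 0 ≤ ρ) (hρ : ρ < 1)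
    (hK : 2 * ((α + β) / (1 - ρ)) * a ≤ 1) (N k : ℕ) :
    ∫⁻ ω, ENNReal.ofReal (Real.exp (∑ i ∈ Finset.range N,
        φ (chain A ζ (k + i) ω) (chain A ζ (k + i + 1) ω))) ∂μ ≤
      ENNReal.ofReal (Real.exp
        (∑ i ∈ Finset.range N, ∫ ω, φ (chain A ζ (k + i) ω) (chain A ζ (k + i + 1) ω) ∂μ +
          4 * a ^ 2 * D * ((α + β) / (1 - ρ)) ^ 2 * (N + 1 / (1 - ρ)))) := by
  have h0 : 0 < 1 - ρ := by linarith
  have hn := hν.integrable_norm ha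
  have h1 := lintegral_exp_sum_chain hφ h hν ha hα hβ hA hρ0 hρ hK N k (W := fun _ => 0)
    measurable_const
  simp only [zero_add] at h1
  have hv : LipBound ((α + β) / (1 - ρ)) (value ν A φ N) :=
    (lipBound_value hφ hα hβ hA hρ0 hρ hn N).mono (by gcongr; nlinarith)
  have h2 := hv.lintegral_exp_chain h hν ha hD hA hρ0 hρ (by positivity) hK k
  refine h1.trans ((mul_le_mul_right h2 _).trans_eq ?_)
  rw [integral_sum_chain hφ h hn hα hβ hA hρ0 hρ, ← ENNReal.ofReal_mul (Real.exp_nonneg _),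
    ← Real.exp_add]
  congr 2
  ring

end Chain

end LowRankVAR

namespace LowRankVAR

/-! ### Transfer to the stationary process by burn-in and coupling. -/

section Stationary

set_option linter.unusedSectionVars false

open Filter Topology

variable {Ω : Type*} [MeasurableSpace Ω] {μ : Measure Ω} [IsProbabilityMeasure μ]
  {E : Type*} [NormedAddCommGroup E] [NormedSpace ℝ E] [MeasurableSpace E] [BorelSpace E]
  [SecondCountableTopology E] {ν : Measure E} [IsProbabilityMeasure ν]
  {A : E →L[ℝ] E} {X ζ : ℕ → Ω → E} {a D ρ : ℝ}

/-- A stationary autoregressive process indexed from `0`, with i.i.d. innovations of law `ν`. -/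
structure IsAR (μ : Measure Ω) (ν : Measure E) (A : E →L[ℝ] E) (X ζ : ℕ → Ω → E) : Prop where
  noise : IsNoise μ ν ζ
  measurable : ∀ k, Measurable (X k)
  recursion : ∀ k, ∀ᵐ ω ∂μ, X (k + 1) ω = A (X k ω) + ζ k ω
  stationary : ∀ h : ℕ, IdentDistrib (fun ω (t : ℕ) => X (h + t) ω) (fun ω (t : ℕ) => X t ω) μ μ

/-- Integrability of the stationary law is not assumed, so the means of `‖X 0‖` and `‖X 1‖` cannot
be subtracted directly. They are truncated at `B`, where stationarity makes them equal and finite;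
Fatou's lemma removes the truncation. -/
theorem IsAR.integrable_norm (hX : IsAR μ ν A X ζ) (hn : Integrable (fun z => ‖z‖) ν)
    (hA : ‖A‖ ≤ ρ) (hρ0 : 0 ≤ ρ) (hρ : ρ < 1) :
    Integrable (fun ω => ‖X 0 ω‖) μ ∧ ∫ ω, ‖X 0 ω‖ ∂μ ≤ (∫ z, ‖z‖ ∂ν) / (1 - ρ) := by
  have h0 : 0 < 1 - ρ := by linarith
  set w := ∫ z, ‖z‖ ∂ν with hw
  have hζi : Integrable (fun ω => ‖ζ 0 ω‖) μ := by
    rw [← hX.noise.law 0] at hn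
    exact (integrable_map_measure (by fun_prop) (hX.noise.measurable 0).aemeasurable).1 hn
  have hζw : ∫ ω, ‖ζ 0 ω‖ ∂μ = w := by
    rw [hw, ← hX.noise.law 0, integral_map (hX.noise.measurable 0).aemeasurable (by fun_prop)]
  have hm0 := (hX.measurable 0).norm
  have hm1 := (hX.measurable 1).norm
  have hmin : ∀ (f : Ω → ℝ) (B : ℕ), Measurable f → (∀ ω, 0 ≤ f ω) →
      Integrable (fun ω => min (f ω) B) μ := fun f B hf hf0 =>
    (integrable_const (B : ℝ)).mono' (hf.min measurable_const).aestronglyMeasurable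
      (.of_forall fun ω => by
        rw [Real.norm_of_nonneg (le_min (hf0 ω) (Nat.cast_nonneg B))]; exact min_le_right _ _)
  have key : ∀ B : ℕ, ∫ ω, (if ‖X 0 ω‖ ≤ B then ‖X 0 ω‖ else 0) ∂μ ≤ w / (1 - ρ) := by
    intro B
    have e1 : ∫ ω, min ‖X 1 ω‖ B ∂μ = ∫ ω, min ‖X 0 ω‖ B ∂μ :=
      ((hX.stationary 1).comp (u := fun x : ℕ → E => min ‖x 0‖ (B : ℝ)) (by fun_prop)).integral_eq
    have i1 := hmin _ B hm1 fun ω => norm_nonneg _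
    have i0 := hmin _ B hm0 fun ω => norm_nonneg _
    have iρ := hmin (fun ω => ρ * ‖X 0 ω‖) B (hm0.const_mul ρ) fun ω => by positivity
    have e2 : ∫ ω, min ‖X 1 ω‖ B ∂μ ≤ ∫ ω, min (ρ * ‖X 0 ω‖) B ∂μ + w := by
      rw [← hζw, ← integral_add iρ hζi]
      refine integral_mono_ae i1 (iρ.add hζi) ?_
      filter_upwards [hX.recursion 0] with ω hω
      have h1 : ‖X 1 ω‖ ≤ ρ * ‖X 0 ω‖ + ‖ζ 0 ω‖ := by
        rw [zero_add] at hω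
        rw [hω]
        exact (norm_add_le _ _).trans (add_le_add_left (A.le_of_opNorm_le hA _) _)
      have h2 := norm_nonneg (ζ 0 ω)
      rcases le_total (ρ * ‖X 0 ω‖) B with h | h
      · rw [min_eq_left h]; exact (min_le_left _ _).trans h1
      · rw [min_eq_right h]; exact (min_le_right _ _).trans (by linarith)
    have i2 : Integrable (fun ω => if ‖X 0 ω‖ ≤ B then ‖X 0 ω‖ else 0) μ :=
      (integrable_const (B : ℝ)).mono'
        (Measurable.ite (measurableSet_le hm0 measurable_const) hm0
          measurable_const).aestronglyMeasurable
        (.of_forall fun ω => by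
          split_ifs with h
          · rwa [norm_norm]
          · simp)
    -- Where `‖X 0‖ ≤ B` neither truncation is active and the difference is `(1 - ρ) ‖X 0‖`;
    -- elsewhere it is nonnegative.
    have e3 : (1 - ρ) * ∫ ω, (if ‖X 0 ω‖ ≤ B then ‖X 0 ω‖ else 0) ∂μ ≤
        ∫ ω, min ‖X 0 ω‖ B ∂μ - ∫ ω, min (ρ * ‖X 0 ω‖) B ∂μ := by
      rw [← integral_const_mul, ← integral_sub i0 iρ]
      refine integral_mono (i2.const_mul _) (i0.sub iρ) fun ω => ?_
      have h1 : ρ * ‖X 0 ω‖ ≤ ‖X 0 ω‖ := mul_le_of_le_one_left (norm_nonneg _) hρ.le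
      simp only
      split_ifs with h
      · rw [min_eq_left h, min_eq_left (h1.trans h)]; linarith
      · rw [mul_zero, sub_nonneg]; exact min_le_min_right _ h1
    rw [le_div_iff₀ h0]
    linarith
  have hlin : ∫⁻ ω, ENNReal.ofReal ‖X 0 ω‖ ∂μ ≤ ENNReal.ofReal (w / (1 - ρ)) := by
    have hmeas : ∀ B : ℕ, Measurable fun ω => if ‖X 0 ω‖ ≤ B then ‖X 0 ω‖ else 0 := fun B =>
      Measurable.ite (measurableSet_le hm0 measurable_const) hm0 measurable_const
    calc ∫⁻ ω, ENNReal.ofReal ‖X 0 ω‖ ∂μ = ∫⁻ ω, liminf (fun B : ℕ =>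
          ENNReal.ofReal (if ‖X 0 ω‖ ≤ B then ‖X 0 ω‖ else 0)) atTop ∂μ := by
          refine lintegral_congr fun ω => (Tendsto.liminf_eq ?_).symm
          refine tendsto_const_nhds.congr' ?_
          obtain ⟨B, hB⟩ := exists_nat_ge ‖X 0 ω‖
          filter_upwards [eventually_ge_atTop B] with b hb
          rw [if_pos (hB.trans (by exact_mod_cast hb))]
      _ ≤ liminf (fun B : ℕ =>
          ∫⁻ ω, ENNReal.ofReal (if ‖X 0 ω‖ ≤ B then ‖X 0 ω‖ else 0) ∂μ) atTop :=
          lintegral_liminf_le fun B => (hmeas B).ennreal_ofReal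
      _ ≤ ENNReal.ofReal (w / (1 - ρ)) := by
          refine liminf_le_of_le (by isBoundedDefault) fun b hb => ?_
          obtain ⟨B, hB⟩ := hb.exists
          refine hB.trans ?_
          rw [← ofReal_integral_eq_lintegral_ofReal]
          · exact ENNReal.ofReal_le_ofReal (key B)
          · refine (integrable_const (B : ℝ)).mono' (hmeas B).aestronglyMeasurable
              (.of_forall fun ω => ?_)
            split_ifs with h
            · rwa [norm_norm]
            · simp
          · exact .of_forall fun ω => by
              simp only [Pi.zero_apply]; split_ifs <;> simp
  have hint : Integrable (fun ω => ‖X 0 ω‖) μ := by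
    refine ⟨hm0.aestronglyMeasurable, ?_⟩
    rw [hasFiniteIntegral_iff_ofReal (.of_forall fun ω => norm_nonneg _)]
    exact hlin.trans_lt ENNReal.ofReal_lt_top
  refine ⟨hint, ?_⟩
  rw [← ofReal_integral_eq_lintegral_ofReal hint (.of_forall fun ω => norm_nonneg _)] at hlin
  refine (ENNReal.ofReal_le_ofReal_iff ?_).1 hlin
  have : 0 ≤ w := integral_nonneg fun z => norm_nonneg z
  positivity

theorem IsAR.integrable_norm_all (hX : IsAR μ ν A X ζ) (hi : Integrable (fun ω => ‖X 0 ω‖) μ)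
    (k : ℕ) : Integrable (fun ω => ‖X k ω‖) μ :=
  (((hX.stationary k).comp (u := fun x : ℕ → E => ‖x 0‖) (by fun_prop)).integrable_iff).2 hi

theorem IsAR.integral_shift (hX : IsAR μ ν A X ζ) {α β : ℝ} {φ : E → E → ℝ} (hφ : LipCost α β φ)
    (k : ℕ) : ∫ ω, φ (X k ω) (X (k + 1) ω) ∂μ = ∫ ω, φ (X 0 ω) (X 1 ω) ∂μ :=
  ((hX.stationary k).comp (u := fun x : ℕ → E => φ (x 0) (x 1))
    (hφ.continuous.measurable.comp (by fun_prop : Measurable fun x : ℕ → E => (x 0, x 1)))).integral_eq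

/-- The stationary process and the chain started at `0` merge at a geometric rate. -/
theorem IsAR.norm_sub_chain_le (hX : IsAR μ ν A X ζ) (hA : ‖A‖ ≤ ρ) (hρ0 : 0 ≤ ρ) :
    ∀ᵐ ω ∂μ, ∀ k, ‖X k ω - chain A ζ k ω‖ ≤ ρ ^ k * ‖X 0 ω‖ := by
  filter_upwards [ae_all_iff.2 hX.recursion] with ω hω k
  induction k with
  | zero => simp [chain]
  | succ k ih =>
    rw [hω k, chain, add_sub_add_right_eq_sub, ← map_sub, pow_succ', mul_assoc]
    exact (A.le_of_opNorm_le hA _).trans (by gcongr)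

/-- Bernstein's inequality for additive functionals of a stationary autoregressive process. -/
theorem IsAR.measure_sum_ge_le (hX : IsAR μ ν A X ζ) (hν : HasExpMoment ν a D) (ha : 0 < a)
    (hD : 0 ≤ D) {α β : ℝ} {φ : E → E → ℝ} (hφ : LipCost α β φ) (hα : 0 ≤ α) (hβ : 0 ≤ β)
    (hA : ‖A‖ ≤ ρ) (hρ0 : 0 ≤ ρ) (hρ : ρ < 1) (hK : 2 * ((α + β) / (1 - ρ)) * a ≤ 1) (N : ℕ)
    (y : ℝ) :
    μ.real {ω | N * ∫ ω, φ (X 0 ω) (X 1 ω) ∂μ + y ≤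
        ∑ i ∈ Finset.range N, φ (X i ω) (X (i + 1) ω)} ≤
      Real.exp (4 * a ^ 2 * D * ((α + β) / (1 - ρ)) ^ 2 * (N + 1 / (1 - ρ)) - y) := by
  have hn := hν.integrable_norm ha
  have hXi := (hX.integrable_norm hn hA hρ0 hρ).1
  set m := ∫ ω, φ (X 0 ω) (X 1 ω) ∂μ with hm
  set C := 4 * a ^ 2 * D * ((α + β) / (1 - ρ)) ^ 2 * (N + 1 / (1 - ρ)) with hC
  set S : ℕ → Ω → ℝ := fun h ω => ∑ i ∈ Finset.range N,
    φ (chain A ζ (h + i) ω) (chain A ζ (h + i + 1) ω) with hS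
  set Z : ℕ → Ω → ℝ := fun h ω => ∑ i ∈ Finset.range N, φ (X (h + i) ω) (X (h + i + 1) ω) with hZ
  set T : ℝ := N * (α + β) with hT
  have hT0 : 0 ≤ T := by positivity
  set w := ∫ ω, ‖X 0 ω‖ ∂μ with hw
  have hw0 : 0 ≤ w := integral_nonneg fun ω => norm_nonneg _
  have hφc : ∀ {U V : Ω → E}, Measurable U → Measurable V → Measurable fun ω => φ (U ω) (V ω) :=
    fun hU hV => hφ.continuous.measurable.comp (hU.prodMk hV)
  have hSm : ∀ h, Measurable (S h) := fun h => Finset.measurable_sum _ fun i _ =>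
    hφc (hX.noise.measurable_chain _) (hX.noise.measurable_chain _)
  have hZm : ∀ h, Measurable (Z h) := fun h => Finset.measurable_sum _ fun i _ =>
    hφc (hX.measurable _) (hX.measurable _)
  have hSi : ∀ h, Integrable (S h) μ := fun h => integrable_finsetSum _ fun i _ =>
    hφ.integrable_chain hX.noise hn _
  have hZt : ∀ h i, Integrable (fun ω => φ (X (h + i) ω) (X (h + i + 1) ω)) μ := fun h i =>
    hφ.integrable_comp (hX.measurable _) (hX.measurable _)
      (hX.integrable_norm_all hXi _) (hX.integrable_norm_all hXi _)
  have hZi : ∀ h, Integrable (Z h) μ := fun h => integrable_finsetSum _ fun i _ => hZt h i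
  have hdiff : ∀ h, ∀ᵐ ω ∂μ, |Z h ω - S h ω| ≤ T * ρ ^ h * ‖X 0 ω‖ := by
    intro h
    filter_upwards [hX.norm_sub_chain_le hA hρ0] with ω hω
    rw [← Finset.sum_sub_distrib]
    refine (Finset.abs_sum_le_sum_abs _ _).trans ?_
    have hle : ∀ i ∈ Finset.range N, |φ (X (h + i) ω) (X (h + i + 1) ω) -
        φ (chain A ζ (h + i) ω) (chain A ζ (h + i + 1) ω)| ≤ (α + β) * (ρ ^ h * ‖X 0 ω‖) := by
      intro i _
      refine (hφ _ _ _ _).trans ?_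
      rw [add_mul]
      gcongr
      · exact (hω _).trans (by gcongr ?_ * _; exact pow_le_pow_of_le_one hρ0 hρ.le (by omega))
      · exact (hω _).trans (by gcongr ?_ * _; exact pow_le_pow_of_le_one hρ0 hρ.le (by omega))
    refine (Finset.sum_le_sum hle).trans_eq ?_
    rw [Finset.sum_const, Finset.card_range, nsmul_eq_mul]
    ring
  have hSmean : ∀ h, ∫ ω, S h ω ∂μ ≤ N * m + T * ρ ^ h * w := by
    intro h
    have h1 : ∫ ω, Z h ω ∂μ = N * m := by
      rw [integral_finsetSum _ fun i _ => hZt h i]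
      simp only [hX.integral_shift hφ]
      simp [hm]
    rw [← h1, hw, ← integral_const_mul, ← integral_add (hZi h) (hXi.const_mul _)]
    refine integral_mono_ae (hSi h) ((hZi h).add (hXi.const_mul _)) ?_
    filter_upwards [hdiff h] with ω hω
    have := (abs_le.1 hω).1
    linarith
  have hStail : ∀ h z, μ.real {ω | z ≤ S h ω} ≤ Real.exp (∫ ω, S h ω ∂μ + C - z) := by
    intro h z
    have h1 := lintegral_exp_chain_le hφ hX.noise hν ha hD hα hβ hA hρ0 hρ hK N h
    rw [← integral_finsetSum _ fun i _ => hφ.integrable_chain hX.noise hn _] at h1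
    have h2 := meas_ge_le_lintegral_div (μ := μ)
      (f := fun ω => ENNReal.ofReal (Real.exp (S h ω))) (hSm h).exp.ennreal_ofReal.aemeasurable
      (ε := ENNReal.ofReal (Real.exp z)) (by simp [Real.exp_pos]) ENNReal.ofReal_ne_top
    have h3 : {ω | ENNReal.ofReal (Real.exp z) ≤ ENNReal.ofReal (Real.exp (S h ω))} =
        {ω | z ≤ S h ω} := by
      ext ω
      simp [ENNReal.ofReal_le_ofReal_iff (Real.exp_nonneg _)]
    rw [h3] at h2
    refine ENNReal.toReal_le_of_le_ofReal (Real.exp_nonneg _) (h2.trans ?_)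
    rw [Real.exp_sub, ENNReal.ofReal_div_of_pos (Real.exp_pos z)]
    gcongr
  have hlaw : ∀ h, μ.real {ω | N * m + y ≤ Z 0 ω} = μ.real {ω | N * m + y ≤ Z h ω} := by
    intro h
    have h1 := ((hX.stationary h).comp
      (u := fun x : ℕ → E => ∑ i ∈ Finset.range N, φ (x i) (x (i + 1)))
      (Finset.measurable_sum _ fun i _ => hφ.continuous.measurable.comp
        (by fun_prop : Measurable fun x : ℕ → E => (x i, x (i + 1))))).measure_mem_eq
        (s := Set.Ici (N * m + y)) measurableSet_Ici
    rw [measureReal_def, measureReal_def]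
    congr 1
    simpa [hZ, Set.preimage, Function.comp_def, add_assoc] using h1.symm
  -- The window is moved to time `h`, then the process is replaced by the chain up to `ε`; Markov's
  -- inequality handles the event where the coupling error exceeds `ε`.
  have hbound : ∀ ε : ℝ, 0 < ε → ∀ h, μ.real {ω | N * m + y ≤ Z 0 ω} ≤
      Real.exp (T * ρ ^ h * w + C - y + ε) + T * ρ ^ h * w / ε := by
    intro ε hε h
    rw [hlaw h]
    have hmarkov : μ.real {ω | ε ≤ T * ρ ^ h * ‖X 0 ω‖} ≤ T * ρ ^ h * w / ε := by
      rw [le_div_iff₀' hε, hw, ← integral_const_mul]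
      exact mul_meas_ge_le_integral_of_nonneg (.of_forall fun ω => by positivity)
        (hXi.const_mul _) ε
    have hsub : {ω | N * m + y ≤ Z h ω} ≤ᵐ[μ]
        ({ω | N * m + y - ε ≤ S h ω} ∪ {ω | ε ≤ T * ρ ^ h * ‖X 0 ω‖} : Set Ω) := by
      filter_upwards [hdiff h] with ω hω h1
      have h1' : N * m + y ≤ Z h ω := h1
      by_cases h2 : ε ≤ T * ρ ^ h * ‖X 0 ω‖
      · exact Or.inr h2
      · left
        have := (abs_le.1 hω).2
        change N * m + y - ε ≤ S h ω
        linarith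
    have h1 : μ.real {ω | N * m + y ≤ Z h ω} ≤
        μ.real ({ω | N * m + y - ε ≤ S h ω} ∪ {ω | ε ≤ T * ρ ^ h * ‖X 0 ω‖} : Set Ω) :=
      ENNReal.toReal_mono (measure_ne_top _ _) (measure_mono_ae hsub)
    refine h1.trans ((measureReal_union_le _ _).trans (add_le_add ((hStail h _).trans ?_) hmarkov))
    refine Real.exp_le_exp.2 ?_
    linarith [hSmean h]
  -- The order of limits matters: `h → ∞` for fixed `ε` kills the coupling error, and only then `ε →
  -- 0`.
  have hpow : Tendsto (fun h : ℕ => T * ρ ^ h * w) atTop (𝓝 0) := by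
    simpa using ((tendsto_pow_atTop_nhds_zero_of_lt_one hρ0 hρ).const_mul T).mul_const w
  have hε : ∀ ε : ℝ, 0 < ε → μ.real {ω | N * m + y ≤ Z 0 ω} ≤ Real.exp (C - y + ε) := by
    intro ε hε
    have h1 : Tendsto (fun h : ℕ => Real.exp (T * ρ ^ h * w + C - y + ε) + T * ρ ^ h * w / ε)
        atTop (𝓝 (Real.exp (0 + C - y + ε) + 0 / ε)) :=
      (Real.continuous_exp.tendsto _ |>.comp
        (((hpow.add_const C).sub_const y).add_const ε)).add (hpow.div_const ε)
    rw [zero_add, zero_div, add_zero] at h1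
    exact ge_of_tendsto' h1 (hbound ε hε)
  have hlim : Tendsto (fun ε : ℝ => Real.exp (C - y + ε)) (𝓝[>] 0) (𝓝 (Real.exp (C - y + 0))) :=
    ((Real.continuous_exp.comp (continuous_const.add continuous_id)).tendsto 0).mono_left
      nhdsWithin_le_nhds
  rw [add_zero] at hlim
  have := ge_of_tendsto hlim (eventually_nhdsWithin_of_forall hε)
  simpa [hZ] using this

end Stationary

end LowRankVAR

namespace LowRankVAR

/-! ### Factorization, compactness and nets of the matrix class. -/

section MatClass

variable {M r : ℕ} {ρ : ℝ}

theorem rank_eq_finrank_range_act (Q : Matrix (Fin M) (Fin M) ℝ) :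
    Q.rank = Module.finrank ℝ 
      (LinearMap.range (act Q : EuclideanSpace ℝ (Fin M) →ₗ[ℝ] EuclideanSpace ℝ (Fin M))) := by
  rw [Matrix.coe_toEuclideanCLM_eq_toEuclideanLin, Matrix.toEuclideanLin, Matrix.toLpLin_eq_toLin]
  exact Matrix.rank_eq_finrank_range_toLin _ _ _

/-- The matrices of the class are the products of two factors of inner dimension `r`. -/
theorem mem_matClass_iff {Q : Matrix (Fin M) (Fin M) ℝ} :
    Q ∈ matClass M ρ r ↔ ∃ (U : EuclideanSpace ℝ (Fin r) →L[ℝ] EuclideanSpace ℝ (Fin M))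
      (V : EuclideanSpace ℝ (Fin M) →L[ℝ] EuclideanSpace ℝ (Fin r)),
      ‖U‖ ≤ 1 ∧ ‖V‖ ≤ ρ ∧ act Q = U ∘L V := by
  constructor
  · rintro ⟨hr, hρ⟩
    rw [schattenInf_eq_opNorm] at hρ
    rw [rank_eq_finrank_range_act] at hr
    set W := LinearMap.range (act Q : EuclideanSpace ℝ (Fin M) →ₗ[ℝ] EuclideanSpace ℝ (Fin M))
    let b := stdOrthonormalBasis ℝ W
    let f : W →ₗ[ℝ] EuclideanSpace ℝ (Fin r) := b.toBasis.constr ℝ fun i =>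
      EuclideanSpace.basisFun (Fin r) ℝ (Fin.castLE hr i)
    have hf : Orthonormal ℝ (f ∘ b.toBasis) := by
      have : f ∘ b.toBasis = fun i => EuclideanSpace.basisFun (Fin r) ℝ (Fin.castLE hr i) := by
        ext1 i
        simp only [Function.comp_apply, f, Module.Basis.constr_basis]
      rw [this]
      exact (EuclideanSpace.basisFun (Fin r) ℝ).orthonormal.comp _ (Fin.castLE_injective hr)
    let J : W →ₗᵢ[ℝ] EuclideanSpace ℝ (Fin r) :=
      f.isometryOfOrthonormal (v := b.toBasis) (by simp) hf
    let T : EuclideanSpace ℝ (Fin M) →L[ℝ] W :=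
      (act Q).codRestrict W fun x => LinearMap.mem_range_self _ x
    have hT : ‖T‖ ≤ ‖act Q‖ :=
      T.opNorm_le_bound (norm_nonneg _) fun x => (act Q).le_opNorm x
    have hJ := J.norm_toContinuousLinearMap_le
    -- The range `W` embeds isometrically in `ℝ^r` by `J`. With `U = ι J*` and `V = J T`, the
    -- identity `J* J = 1` gives the product, `U` is a contraction and `V` carries the whole norm of
    -- `Q`.
    refine ⟨W.subtypeL ∘L ContinuousLinearMap.adjoint J.toContinuousLinearMap,
      J.toContinuousLinearMap ∘L T, ?_, ?_, ?_⟩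
    · refine (ContinuousLinearMap.opNorm_comp_le _ _).trans ?_
      rw [LinearIsometryEquiv.norm_map]
      calc _ ≤ (1 : ℝ) * 1 := mul_le_mul W.subtypeₗᵢ.norm_toContinuousLinearMap_le hJ
            (ContinuousLinearMap.opNorm_nonneg _) zero_le_one
        _ = 1 := one_mul _
    · refine (ContinuousLinearMap.opNorm_comp_le _ _).trans ?_
      calc _ ≤ 1 * ‖act Q‖ := by gcongr
        _ ≤ ρ := by rwa [one_mul]
    · have hJJ : ∀ w, ContinuousLinearMap.adjoint J.toContinuousLinearMap
          (J.toContinuousLinearMap w) = w := fun w => by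
        refine ext_inner_right ℝ fun v => ?_
        rw [ContinuousLinearMap.adjoint_inner_left]
        exact J.inner_map_map w v
      ext1 x
      simp only [ContinuousLinearMap.comp_apply, hJJ]
      rfl
  · rintro ⟨U, V, hU, hV, hQ⟩
    refine ⟨?_, ?_⟩
    · rw [rank_eq_finrank_range_act, hQ]
      have h1 : LinearMap.range ((U ∘L V : _ →L[ℝ] _) : EuclideanSpace ℝ (Fin M) →ₗ[ℝ] _) ≤
          LinearMap.range (U : EuclideanSpace ℝ (Fin r) →ₗ[ℝ] EuclideanSpace ℝ (Fin M)) := by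
        rintro _ ⟨x, rfl⟩
        exact ⟨V x, rfl⟩
      refine (Submodule.finrank_mono h1).trans ((LinearMap.finrank_range_le _).trans ?_)
      simp
    · rw [schattenInf_eq_opNorm, hQ]
      refine (ContinuousLinearMap.opNorm_comp_le _ _).trans ?_
      calc _ ≤ 1 * ρ := by gcongr
        _ = ρ := one_mul _

/-- By the factorization, the class is the continuous image of a product of two compact balls;
closedness of the rank constraint need not be shown separately. -/
theorem isCompact_act_image_matClass : IsCompact (act '' matClass M ρ r) := by
  have h : act '' matClass M ρ r = (fun p : (EuclideanSpace ℝ (Fin r) →L[ℝ] EuclideanSpace ℝ (Fin M))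
      × (EuclideanSpace ℝ (Fin M) →L[ℝ] EuclideanSpace ℝ (Fin r)) => p.1 ∘L p.2) ''
      (Metric.closedBall 0 1 ×ˢ Metric.closedBall 0 ρ) := by
    ext B
    constructor
    · rintro ⟨Q, hQ, rfl⟩
      obtain ⟨U, V, hU, hV, hUV⟩ := mem_matClass_iff.1 hQ
      exact ⟨(U, V), ⟨by simpa using hU, by simpa using hV⟩, hUV.symm⟩
    · rintro ⟨⟨U, V⟩, ⟨hU, hV⟩, rfl⟩
      obtain ⟨Q, hQ⟩ := (Matrix.toEuclideanCLM (n := Fin M) (𝕜 := ℝ)).surjective (U ∘L V)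
      exact ⟨Q, mem_matClass_iff.2 ⟨U, V, by simpa using hU, by simpa using hV, hQ⟩, hQ⟩
  rw [h]
  have := FiniteDimensional.proper ℝ (EuclideanSpace ℝ (Fin r) →L[ℝ] EuclideanSpace ℝ (Fin M))
  have := FiniteDimensional.proper ℝ (EuclideanSpace ℝ (Fin M) →L[ℝ] EuclideanSpace ℝ (Fin r))
  exact ((isCompact_closedBall _ _).prod (isCompact_closedBall _ _)).image
    (continuous_fst.clm_comp continuous_snd)

/-- Continuous functions of the operator attain their minimum on the class. -/
theorem exists_isMinOn_matClass (hne : (matClass M ρ r).Nonempty)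
    {F : (EuclideanSpace ℝ (Fin M) →L[ℝ] EuclideanSpace ℝ (Fin M)) → ℝ} (hF : Continuous F) :
    ∃ Q ∈ matClass M ρ r, ∀ Q' ∈ matClass M ρ r, F (act Q) ≤ F (act Q') := by
  obtain ⟨_, ⟨Q, hQ, rfl⟩, h⟩ := isCompact_act_image_matClass.exists_isMinOn (hne.image act)
    hF.continuousOn
  exact ⟨Q, hQ, fun Q' hQ' => h ⟨Q', hQ', rfl⟩⟩

theorem finrank_clm_euclideanSpace (m n : ℕ) :
    Module.finrank ℝ (EuclideanSpace ℝ (Fin m) →L[ℝ] EuclideanSpace ℝ (Fin n)) = m * n := by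
  rw [← (LinearMap.toContinuousLinearMap (𝕜 := ℝ) (E := EuclideanSpace ℝ (Fin m))
    (F' := EuclideanSpace ℝ (Fin n))).finrank_eq, Module.finrank_linearMap]
  simp

/-- A net of the class whose size depends on the rank. -/
theorem exists_finset_net_matClass (hρ0 : 0 ≤ ρ) (hρ : ρ ≤ 1) {ε : ℝ} (hε : 0 < ε) :
    ∃ t : Finset (EuclideanSpace ℝ (Fin M) →L[ℝ] EuclideanSpace ℝ (Fin M)),
      (∀ B ∈ t, ‖B‖ ≤ ρ) ∧ (∀ Q ∈ matClass M ρ r, ∃ B ∈ t, ‖act Q - B‖ ≤ 2 * ε) ∧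
      (t.card : ℝ) ≤ (1 + 2 / ε) ^ (2 * (M * r)) := by
  classical
  obtain ⟨t₁, h₁, c₁, n₁⟩ := exists_finset_cover_closedBall
    (F := EuclideanSpace ℝ (Fin r) →L[ℝ] EuclideanSpace ℝ (Fin M)) zero_le_one hε
  obtain ⟨t₂, h₂, c₂, n₂⟩ := exists_finset_cover_closedBall
    (F := EuclideanSpace ℝ (Fin M) →L[ℝ] EuclideanSpace ℝ (Fin r)) hρ0 hε
  rw [finrank_clm_euclideanSpace] at n₁ n₂
  refine ⟨(t₁ ×ˢ t₂).image fun p => p.1 ∘L p.2, ?_, ?_, ?_⟩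
  · intro B hB
    obtain ⟨⟨U, V⟩, hp, rfl⟩ := Finset.mem_image.1 hB
    obtain ⟨hU, hV⟩ := Finset.mem_product.1 hp
    refine (ContinuousLinearMap.opNorm_comp_le _ _).trans ?_
    calc _ ≤ 1 * ρ := by gcongr; exacts [h₁ U hU, h₂ V hV]
      _ = ρ := one_mul _
  · intro Q hQ
    obtain ⟨U, V, hU, hV, hUV⟩ := mem_matClass_iff.1 hQ
    obtain ⟨U', hU', hUU⟩ := c₁ U hU
    obtain ⟨V', hV', hVV⟩ := c₂ V hV
    refine ⟨U' ∘L V', Finset.mem_image.2 ⟨(U', V'), Finset.mem_product.2 ⟨hU', hV'⟩, rfl⟩, ?_⟩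
    -- Changing one factor at a time costs `ε` each, as the other factor has norm at most `1`.
    have h : act Q - U' ∘L V' = (U - U') ∘L V + U' ∘L (V - V') := by
      rw [hUV]; ext1 x; simp
    rw [h]
    refine (norm_add_le _ _).trans ((add_le_add (ContinuousLinearMap.opNorm_comp_le _ _)
      (ContinuousLinearMap.opNorm_comp_le _ _)).trans ?_)
    calc _ ≤ ε * 1 + 1 * ε := by gcongr; exacts [hV.trans hρ, h₁ U' hU']
      _ = 2 * ε := by ring
  · calc (((t₁ ×ˢ t₂).image fun p => p.1 ∘L p.2).card : ℝ) ≤ (t₁.card : ℝ) * t₂.card := by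
          rw [← Nat.cast_mul, ← Finset.card_product]
          exact Nat.cast_le.2 Finset.card_image_le
      _ ≤ (1 + 2 / ε) ^ (M * r) * (1 + 2 / ε) ^ (M * r) := by
          gcongr
          · refine n₁.trans_eq ?_
            rw [mul_one, mul_comm r]
          · refine n₂.trans ?_
            gcongr
            linarith
      _ = _ := by rw [two_mul, pow_add]

end MatClass

end LowRankVAR

namespace LowRankVAR

/-! ### Bernstein's inequality in terms of `𝒱₀` and `δ₀`. -/

section Bernstein

variable {Ω : Type*} [MeasurableSpace Ω] {μ : Measure Ω} {M : ℕ}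

/-- Time is shifted so that the first observation has index `0`; the transition from index `k` to `k
+ 1` is then driven by `ξ (k + 2)`. -/
theorem IsStationaryVAR.isAR {A : Matrix (Fin M) (Fin M) ℝ} {X ξ : ℕ → Ω → EuclideanSpace ℝ (Fin M)}
    (h : IsStationaryVAR μ A X ξ) :
    IsAR μ (μ.map (ξ 0)) (act A) (fun k => X (k + 1)) (fun k => ξ (k + 2)) where
  noise :=
    { measurable := fun k => h.measurable_noise _
      indep := h.indep_noise.precomp (add_left_injective 2)
      law := fun k => (h.ident_noise (k + 2) 0).map_eq }
  measurable := fun k => h.measurable_process _ (by omega)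
  recursion := fun k => by simpa using h.recursion (k + 2) (by omega)
  stationary := fun k => by
    have := h.stationary k
    simp only [add_comm 1, add_right_comm _ 1 k] at this
    simpa only [add_comm k] using this

variable [IsProbabilityMeasure μ] {ν : Measure (EuclideanSpace ℝ (Fin M))} [IsProbabilityMeasure ν]
  {A : EuclideanSpace ℝ (Fin M) →L[ℝ] EuclideanSpace ℝ (Fin M)}
  {X ζ : ℕ → Ω → EuclideanSpace ℝ (Fin M)} {c d ρ : ℝ}

theorem V₀_pos (hc : 0 < c) (hd : 0 < d) (hρ : ρ < 1) : 0 < V₀ ρ c d := by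
  have h0 : 0 < 1 - ρ := by linarith
  have h1 : 0 < 2 - ρ := by linarith
  unfold V₀; positivity

theorem δ₀_pos (hc : 0 < c) (hρ : ρ < 1) : 0 < δ₀ ρ c := by
  have h0 : 0 < 1 - ρ := by linarith
  unfold δ₀; positivity

/-- The burn-in term `1 / (1 - ρ)` is absorbed using `N ≥ 1`, which turns `1 + 1 / (1 - ρ)` into the
factor `(2 - ρ) / (1 - ρ)` of `𝒱₀`; the constant `2` is bounded by `e`. -/
theorem exponent_le_V₀ (hc : 0 < c) (hd : 0 < d) (hρ : ρ < 1) {N : ℝ} (hN : 1 ≤ N)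
    (u : ℝ) : 8 * d * c ^ 2 * u ^ 2 / (1 - ρ) ^ 2 * (N + 1 / (1 - ρ)) ≤ N * V₀ ρ c d * u ^ 2 / 2 := by
  have h0 : 0 < 1 - ρ := by linarith
  have he : 2 ≤ Real.exp 1 := by have := Real.add_one_le_exp (1 : ℝ); linarith
  have key : 2 * (N + 1 / (1 - ρ)) ≤ N * (Real.exp 1 * ((2 - ρ) / (1 - ρ))) := by
    have h1 : (2 - ρ) / (1 - ρ) = 1 + 1 / (1 - ρ) := by field_simp; ring
    have h2 : 0 < 1 / (1 - ρ) := by positivity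
    calc 2 * (N + 1 / (1 - ρ)) ≤ N * (2 * (1 + 1 / (1 - ρ))) := by nlinarith
      _ ≤ _ := by rw [h1]; gcongr
  calc _ = 4 * d * c ^ 2 * u ^ 2 / (1 - ρ) ^ 2 * (2 * (N + 1 / (1 - ρ))) := by ring
    _ ≤ 4 * d * c ^ 2 * u ^ 2 / (1 - ρ) ^ 2 * (N * (Real.exp 1 * ((2 - ρ) / (1 - ρ)))) := by gcongr
    _ = _ := by unfold V₀; field_simp; ring

/-- Bernstein's inequality with the constants `𝒱₀` and `δ₀`. -/
theorem IsAR.measure_sum_ge_le_V₀ (hX : IsAR μ ν A X ζ) (hM : 1 ≤ M) (hc : 0 < c) (hd : 0 < d)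
    (hν : HasExpMoment ν (c * √M) (2 * d)) (hA : ‖A‖ ≤ ρ) (hρ0 : 0 ≤ ρ) (hρ : ρ < 1)
    {α β : ℝ} (hα : 0 ≤ α) (hβ : 0 ≤ β) (hαβ : 0 < α + β)
    {φ : EuclideanSpace ℝ (Fin M) → EuclideanSpace ℝ (Fin M) → ℝ} (hφ : LipCost α β φ)
    {u : ℝ} (hu : 0 < u) (hu1 : δ₀ ρ c * u ≤ 1) {N : ℕ} (hN : 1 ≤ N) (x : ℝ) :
    μ.real {ω | N * ∫ ω, φ (X 0 ω) (X 1 ω) ∂μ + (α + β) * √M * (N * V₀ ρ c d * u / 2 + x / u) ≤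
        ∑ i ∈ Finset.range N, φ (X i ω) (X (i + 1) ω)} ≤ Real.exp (-x) := by
  have h0 : 0 < 1 - ρ := by linarith
  have hM' : 0 < √(M : ℝ) := Real.sqrt_pos.2 (by exact_mod_cast hM)
  -- This scaling gives the cost `s φ` total Lipschitz constant `u / √M`, so that the smallness
  -- condition at noise scale `c √M` becomes `δ₀ u ≤ 1`.
  set s : ℝ := u / ((α + β) * √M) with hs
  have hs0 : 0 < s := by positivity
  have hφ' : LipCost (s * α) (s * β) fun x y => s * φ x y := fun x y x' y' => by
    rw [← mul_sub, abs_mul, abs_of_pos hs0, mul_assoc, mul_assoc, ← mul_add]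
    exact mul_le_mul_of_nonneg_left (hφ x y x' y') hs0.le
  have hκ : (s * α + s * β) * √M = u := by rw [hs]; field_simp
  have hK : 2 * ((s * α + s * β) / (1 - ρ)) * (c * √M) ≤ 1 := by
    refine le_trans (le_of_eq ?_) hu1
    rw [← hκ, δ₀]; ring
  have h := hX.measure_sum_ge_le hν (by positivity) (by positivity) hφ' (by positivity)
    (by positivity) hA hρ0 hρ hK N (N * V₀ ρ c d * u ^ 2 / 2 + x)
  have hexp := exponent_le_V₀ hc hd hρ (N := N) (by exact_mod_cast hN) u
  have h4 : 4 * (c * √M) ^ 2 * (2 * d) * ((s * α + s * β) / (1 - ρ)) ^ 2 * (N + 1 / (1 - ρ)) =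
      8 * d * c ^ 2 * u ^ 2 / (1 - ρ) ^ 2 * (N + 1 / (1 - ρ)) := by
    rw [← hκ, div_pow]; ring
  rw [h4] at h
  refine le_trans (le_of_eq ?_) (h.trans (Real.exp_le_exp.2 (by linarith)))
  congr 1
  ext ω
  simp only [Set.mem_ofPred_eq, ← Finset.mul_sum, integral_const_mul]
  have h5 : N * (s * ∫ ω, φ (X 0 ω) (X 1 ω) ∂μ) + (N * V₀ ρ c d * u ^ 2 / 2 + x) =
      s * (N * ∫ ω, φ (X 0 ω) (X 1 ω) ∂μ +
        (α + β) * √M * (N * V₀ ρ c d * u / 2 + x / u)) := by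
    rw [hs]; field_simp
  rw [h5, mul_le_mul_iff_right₀ hs0]

end Bernstein

/-! ### Lipschitz dependence of the loss and of the risk. -/

section Risk

variable {M : ℕ}

theorem lipCost_loss {ℓ : EuclideanSpace ℝ (Fin M) → ℝ} {L : ℝ≥0} (hL : L ≤ 1)
    (hℓ : LipschitzWith L ℓ) {ρ : ℝ} {B : EuclideanSpace ℝ (Fin M) →L[ℝ] EuclideanSpace ℝ (Fin M)}
    (hB : ‖B‖ ≤ ρ) : LipCost ρ 1 fun x y => ℓ (y - B x) := fun x y x' y' => by
  have h1 := (hℓ.weaken hL).dist_le_mul (y - B x) (y' - B x')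
  rw [Real.dist_eq, dist_eq_norm, NNReal.coe_one, one_mul] at h1
  refine h1.trans ?_
  have h2 : y - B x - (y' - B x') = (y - y') - B (x - x') := by rw [map_sub]; abel
  rw [h2]
  refine (norm_sub_le _ _).trans ?_
  linarith [B.le_of_opNorm_le hB (x - x')]

theorem abs_loss_sub_le {ℓ : EuclideanSpace ℝ (Fin M) → ℝ} {L : ℝ≥0} (hL : L ≤ 1)
    (hℓ : LipschitzWith L ℓ) (B B' : EuclideanSpace ℝ (Fin M) →L[ℝ] EuclideanSpace ℝ (Fin M))
    (x y : EuclideanSpace ℝ (Fin M)) : |ℓ (y - B x) - ℓ (y - B' x)| ≤ ‖B - B'‖ * ‖x‖ := by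
  have h1 := (hℓ.weaken hL).dist_le_mul (y - B x) (y - B' x)
  rw [Real.dist_eq, dist_eq_norm, NNReal.coe_one, one_mul, sub_sub_sub_cancel_left,
    norm_sub_rev] at h1
  exact h1.trans ((B - B').le_opNorm x)

variable {Ω : Type*} [MeasurableSpace Ω] {μ : Measure Ω} [IsProbabilityMeasure μ]
  {U V : Ω → EuclideanSpace ℝ (Fin M)}

theorem abs_integral_loss_sub_le {ℓ : EuclideanSpace ℝ (Fin M) → ℝ} {L : ℝ≥0} (hL : L ≤ 1)
    (hℓ : LipschitzWith L ℓ) (hU : Measurable U) (hV : Measurable V)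
    (hUi : Integrable (fun ω => ‖U ω‖) μ) (hVi : Integrable (fun ω => ‖V ω‖) μ)
    (B B' : EuclideanSpace ℝ (Fin M) →L[ℝ] EuclideanSpace ℝ (Fin M)) :
    |∫ ω, ℓ (V ω - B (U ω)) ∂μ - ∫ ω, ℓ (V ω - B' (U ω)) ∂μ| ≤ ‖B - B'‖ * ∫ ω, ‖U ω‖ ∂μ := by
  have h := (lipCost_loss hL hℓ le_rfl (B := B)).integrable_comp hU hV hUi hVi
  have h' := (lipCost_loss hL hℓ le_rfl (B := B')).integrable_comp hU hV hUi hVi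
  rw [← integral_sub h h', ← integral_const_mul]
  exact abs_integral_le_integral_abs.trans
    (integral_mono (h.sub h').abs (hUi.const_mul _) fun ω => abs_loss_sub_le hL hℓ B B' _ _)

theorem continuous_integral_loss {ℓ : EuclideanSpace ℝ (Fin M) → ℝ} {L : ℝ≥0} (hL : L ≤ 1)
    (hℓ : LipschitzWith L ℓ) (hU : Measurable U) (hV : Measurable V)
    (hUi : Integrable (fun ω => ‖U ω‖) μ) (hVi : Integrable (fun ω => ‖V ω‖) μ) :
    Continuous fun B : EuclideanSpace ℝ (Fin M) →L[ℝ] EuclideanSpace ℝ (Fin M) =>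
      ∫ ω, ℓ (V ω - B (U ω)) ∂μ := by
  refine (LipBound.continuous (K := ∫ ω, ‖U ω‖ ∂μ) fun B B' => ?_)
  rw [mul_comm]
  exact abs_integral_loss_sub_le hL hℓ hU hV hUi hVi B B'

theorem empError_eq_sum_range {n : ℕ} (hn : 1 ≤ n) (ℓ : EuclideanSpace ℝ (Fin M) → ℝ)
    (x : ℕ → EuclideanSpace ℝ (Fin M)) (Q : Matrix (Fin M) (Fin M) ℝ) :
    empError n ℓ x Q =
      1 / ((n - 1 : ℕ) : ℝ) * ∑ i ∈ Finset.range (n - 1), ℓ (x (i + 1 + 1) - act Q (x (i + 1))) := by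
  rw [empError, Nat.cast_sub hn, Nat.cast_one]
  congr 1
  refine Finset.sum_nbij' (fun i => i - 2) (fun i => i + 2) ?_ ?_ ?_ ?_ ?_
  · intro i hi; simp only [Finset.mem_Icc, Finset.mem_range] at hi ⊢; omega
  · intro i hi; simp only [Finset.mem_Icc, Finset.mem_range] at hi ⊢; omega
  · intro i hi; simp only [Finset.mem_Icc] at hi; omega
  · intro i hi; simp
  · intro i hi
    simp only [Finset.mem_Icc] at hi
    rw [show i - 2 + 1 + 1 = i by omega, show i - 2 + 1 = i - 1 by omega]

end Risk

end LowRankVAR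

namespace LowRankVAR

/-! ### Choice of the parameters and the oracle inequality on one event. -/

section Oracle

variable {Ω : Type*} [MeasurableSpace Ω] {μ : Measure Ω} [IsProbabilityMeasure μ] {M r n : ℕ}
  {c d ρ η : ℝ}

/-- The estimation and confidence terms produced by the choice
`u = √(4 M r log(9 r n) / ((n - 1) 𝒱₀))` of the Laplace parameter. -/
theorem exists_laplace_parameter (hM : 1 ≤ M) (hr : 1 ≤ r) (hc : 0 < c) (hd : 0 < d) (hρ : ρ < 1)
    (hn0 : 1 ≤ n)
    (hn : 1 + 16 * δ₀ ρ c ^ 2 * M * r * Real.log (9 * r * n) / V₀ ρ c d ≤ (n : ℝ)) :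
    ∃ u : ℝ, 0 < u ∧ δ₀ ρ c * u ≤ 1 ∧
      √M * (V₀ ρ c d * u + 2 * (M * r) * Real.log (9 * r * n) / (u * ((n : ℝ) - 1))) ≤
        4 * √(4 * V₀ ρ c d * M ^ 2 * r * Real.log (9 * r * n) / (n - 1)) ∧
      √M / (u * ((n : ℝ) - 1)) = √(V₀ ρ c d / (4 * (n - 1) * r * Real.log (9 * r * n))) := by
  have hV := V₀_pos hc hd hρ
  have hδ := δ₀_pos hc hρ
  have hM' : (1 : ℝ) ≤ M := by exact_mod_cast hM
  have hr' : (1 : ℝ) ≤ r := by exact_mod_cast hr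
  have hn' : (1 : ℝ) ≤ n := by exact_mod_cast hn0
  have hΛ : 0 < Real.log (9 * r * n) := Real.log_pos (by nlinarith [mul_le_mul hr' hn' zero_le_one (by linarith)])
  set Λ := Real.log (9 * r * n)
  set V := V₀ ρ c d
  set δ := δ₀ ρ c
  set N : ℝ := (n : ℝ) - 1 with hN
  have hN0 : 0 < N := by
    have : 0 < 16 * δ ^ 2 * M * r * Λ / V := by positivity
    linarith
  have hnN : 16 * δ ^ 2 * M * r * Λ ≤ N * V := by
    rw [← div_le_iff₀ hV]; linarith
  set u := √(4 * M * r * Λ / (N * V)) with hu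
  have hu0 : 0 < u := Real.sqrt_pos.2 (by positivity)
  have hu2 : u ^ 2 = 4 * M * r * Λ / (N * V) := Real.sq_sqrt (by positivity)
  refine ⟨u, hu0, ?_, ?_, ?_⟩
  · rw [← sq_le_one_iff₀ (by positivity), mul_pow, hu2, ← mul_div_assoc, div_le_one (by positivity)]
    nlinarith [mul_pos hN0 hV]
  -- This `u` makes the entropy term half of the variance term `V u`, so `3/2` would do in place of
  -- the factor `4`.
  · have h1 : 2 * (M * r) * Λ / (u * N) = V * u / 2 := by
      rw [div_eq_div_iff (by positivity) (by norm_num)]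
      calc 2 * (M * r) * Λ * 2 = 4 * M * r * Λ / (N * V) * (N * V) := by field_simp; ring
        _ = _ := by rw [← hu2]; ring
    have h2 : √M * (V * u) = √(4 * V * M ^ 2 * r * Λ / N) := by
      rw [eq_comm, Real.sqrt_eq_iff_mul_self_eq (by positivity) (by positivity)]
      symm
      calc _ = √M ^ 2 * V ^ 2 * u ^ 2 := by ring
        _ = _ := by rw [hu2, Real.sq_sqrt (by positivity)]; field_simp
    rw [h1, ← h2]
    have : 0 ≤ √M * (V * u) := by positivity
    linarith
  · rw [eq_comm, Real.sqrt_eq_iff_mul_self_eq (by positivity) (by positivity)]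
    symm
    calc _ = √M ^ 2 / (u ^ 2 * N ^ 2) := by rw [← sq, div_pow, mul_pow]
      _ = _ := by rw [hu2, Real.sq_sqrt (by positivity)]; field_simp

/-- At radius `1 / (2 n)` the base of the covering bound is `1 + 4 n`, which is at most `9 r n`. -/
theorem log_card_net_le {T : ℝ} (hT0 : 0 < T) (hr : 1 ≤ r) (hn0 : 1 ≤ n)
    (hT : T ≤ (1 + 2 / (1 / (2 * (n : ℝ)))) ^ (2 * (M * r))) :
    Real.log T ≤ 2 * (M * r) * Real.log (9 * r * n) := by
  have hr' : (1 : ℝ) ≤ r := by exact_mod_cast hr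
  have hn' : (1 : ℝ) ≤ n := by exact_mod_cast hn0
  have h1 : T ≤ (9 * r * n : ℝ) ^ (2 * (M * r)) := by
    refine hT.trans (pow_le_pow_left₀ (by positivity) ?_ _)
    rw [one_div, div_inv_eq_mul]
    nlinarith
  refine (Real.log_le_log hT0 h1).trans_eq ?_
  rw [Real.log_pow]
  push_cast
  ring

/-- The oracle inequality on the intersection of the deviation events, with a free Laplace
parameter. -/
theorem exists_event_risk_le {A : Matrix (Fin M) (Fin M) ℝ}
    {X ζ : ℕ → Ω → EuclideanSpace ℝ (Fin M)} {ν : Measure (EuclideanSpace ℝ (Fin M))}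
    [IsProbabilityMeasure ν] (hX : IsAR μ ν (act A) X ζ) (hM : 1 ≤ M) (hc : 0 < c) (hd : 0 < d)
    (hν : HasExpMoment ν (c * √M) (2 * d)) (hA : ‖act A‖ ≤ ρ) (hρ0 : 0 ≤ ρ) (hρ : ρ < 1)
    {ℓ : EuclideanSpace ℝ (Fin M) → ℝ} {L : ℝ≥0} (hL : L ≤ 1) (hℓ : LipschitzWith L ℓ)
    (hη : 0 < η) {N : ℕ} (hN : 1 ≤ N)
    {C : Set (EuclideanSpace ℝ (Fin M) →L[ℝ] EuclideanSpace ℝ (Fin M))}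
    {Q₀ : EuclideanSpace ℝ (Fin M) →L[ℝ] EuclideanSpace ℝ (Fin M)} (hQ₀ : Q₀ ∈ C) (hQρ : ‖Q₀‖ ≤ ρ)
    {t : Finset (EuclideanSpace ℝ (Fin M) →L[ℝ] EuclideanSpace ℝ (Fin M))} {ε : ℝ} (hε : 0 ≤ ε)
    (ht : ∀ B ∈ t, ‖B‖ ≤ ρ) (htC : ∀ Q ∈ C, ∃ B ∈ t, ‖Q - B‖ ≤ ε)
    {u : ℝ} (hu : 0 < u) (hu1 : δ₀ ρ c * u ≤ 1) :
    ∃ E : Set Ω, MeasurableSet E ∧ 1 - η ≤ μ.real E ∧ ∀ ω ∈ E, ∀ Q ∈ C,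
      (∀ Q' ∈ C, ∑ i ∈ Finset.range N, ℓ (X (i + 1) ω - Q (X i ω)) ≤
        ∑ i ∈ Finset.range N, ℓ (X (i + 1) ω - Q' (X i ω))) →
      ∫ ω, ℓ (X 1 ω - Q (X 0 ω)) ∂μ ≤ ∫ ω, ℓ (X 1 ω - Q₀ (X 0 ω)) ∂μ
        + (1 + ρ) * √M * (V₀ ρ c d * u + Real.log t.card / (u * N))
        + 2 * (1 + ρ) * Real.log (4 / η) * (√M / (u * N))
        + ε * √M * (4 * d * c / (1 - ρ) + V₀ ρ c d / (4 * δ₀ ρ c)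
          + 2 * δ₀ ρ c * Real.log (2 / η) / N) := by
  have h0 : 0 < 1 - ρ := by linarith
  have hN' : (0 : ℝ) < N := by exact_mod_cast hN
  have hM' : 0 < √(M : ℝ) := Real.sqrt_pos.2 (by exact_mod_cast hM)
  have hδ := δ₀_pos hc hρ
  have hn := hν.integrable_norm (by positivity)
  obtain ⟨hX0, hw⟩ := hX.integrable_norm hn hA hρ0 hρ
  have hXi := hX.integrable_norm_all hX0
  have hwle : ∫ ω, ‖X 0 ω‖ ∂μ ≤ √M * (2 * d * c / (1 - ρ)) := by
    refine hw.trans ?_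
    have := hν.integral_norm_le (by positivity)
    calc _ ≤ c * √M * (2 * d) / (1 - ρ) := by gcongr
      _ = _ := by ring
  set w := ∫ ω, ‖X 0 ω‖ ∂μ
  set R : (EuclideanSpace ℝ (Fin M) →L[ℝ] EuclideanSpace ℝ (Fin M)) → ℝ :=
    fun B => ∫ ω, ℓ (X 1 ω - B (X 0 ω)) ∂μ with hR
  obtain ⟨B₀, hB₀, -⟩ := htC Q₀ hQ₀
  have hT : (0 : ℝ) < t.card := by exact_mod_cast Finset.card_pos.2 ⟨B₀, hB₀⟩
  have hφm : ∀ {α β : ℝ} {φ : EuclideanSpace ℝ (Fin M) → EuclideanSpace ℝ (Fin M) → ℝ},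
      LipCost α β φ → Measurable fun ω => ∑ i ∈ Finset.range N, φ (X i ω) (X (i + 1) ω) :=
    fun hφ => Finset.measurable_sum _ fun i _ =>
      hφ.continuous.measurable.comp ((hX.measurable _).prodMk (hX.measurable _))
  -- the three kinds of exceptional events
  have hlipn : LipCost 1 0 fun x _ : EuclideanSpace ℝ (Fin M) => ‖x‖ := fun x y x' y' => by
    simpa using abs_norm_sub_norm_le x x'
  -- The mean norm controls the discretization error. Its Laplace parameter is half the largest one
  -- allowed, independently of `u`. The levels are `η / 2` here, `η / 4` for `Q₀`, and `η / 4`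
  -- shared by the net.
  have b₁ := hX.measure_sum_ge_le_V₀ hM hc hd hν hA hρ0 hρ zero_le_one le_rfl (by norm_num) hlipn
    (u := 1 / (2 * δ₀ ρ c)) (by positivity) (by field_simp; norm_num) hN (Real.log (2 / η))
  set F₁ : Set Ω := {ω | N * w + (1 + 0) * √M * (N * V₀ ρ c d * (1 / (2 * δ₀ ρ c)) / 2 +
      Real.log (2 / η) / (1 / (2 * δ₀ ρ c))) ≤ ∑ i ∈ Finset.range N, ‖X i ω‖} with hF₁
  have m₁ : MeasurableSet F₁ := measurableSet_le measurable_const (hφm hlipn)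
  have lipp : ∀ B : EuclideanSpace ℝ (Fin M) →L[ℝ] EuclideanSpace ℝ (Fin M), ‖B‖ ≤ ρ →
      LipCost ρ 1 fun x y => ℓ (y - B x) := fun B hB => lipCost_loss hL hℓ hB
  have lipm : ∀ B : EuclideanSpace ℝ (Fin M) →L[ℝ] EuclideanSpace ℝ (Fin M), ‖B‖ ≤ ρ →
      LipCost ρ 1 fun x y => -ℓ (y - B x) := fun B hB x y x' y' => by
    rw [neg_sub_neg, abs_sub_comm]
    exact lipp B hB x y x' y'
  have b₂ := hX.measure_sum_ge_le_V₀ hM hc hd hν hA hρ0 hρ hρ0 zero_le_one (by linarith)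
    (lipp Q₀ hQρ) hu hu1 hN (Real.log (4 / η))
  set F₂ : Set Ω := {ω | N * R Q₀ + (ρ + 1) * √M * (N * V₀ ρ c d * u / 2 +
      Real.log (4 / η) / u) ≤ ∑ i ∈ Finset.range N, ℓ (X (i + 1) ω - Q₀ (X i ω))} with hF₂
  have m₂ : MeasurableSet F₂ := measurableSet_le measurable_const (hφm (lipp Q₀ hQρ))
  -- The empirical risk must not fall far below the risk, hence the sign; the minimizer is
  -- data-dependent, hence every net point is needed. The oracle `Q₀` is deterministic and needs a
  -- single event.
  have b₃ := fun B hB => hX.measure_sum_ge_le_V₀ hM hc hd hν hA hρ0 hρ hρ0 zero_le_one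
    (by linarith) (lipm B (ht B hB)) hu hu1 hN (Real.log (4 * t.card / η))
  set F₃ : (EuclideanSpace ℝ (Fin M) →L[ℝ] EuclideanSpace ℝ (Fin M)) → Set Ω := fun B =>
    {ω | N * ∫ ω, -ℓ (X 1 ω - B (X 0 ω)) ∂μ + (ρ + 1) * √M * (N * V₀ ρ c d * u / 2 +
      Real.log (4 * t.card / η) / u) ≤ ∑ i ∈ Finset.range N, -ℓ (X (i + 1) ω - B (X i ω))} with hF₃
  have m₃ : ∀ B ∈ t, MeasurableSet (F₃ B) := fun B hB =>
    measurableSet_le measurable_const (hφm (lipm B (ht B hB)))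
  have m₃' : MeasurableSet (⋃ B ∈ t, F₃ B) := Finset.measurableSet_biUnion _ m₃
  have hexp : ∀ x : ℝ, 0 < x → Real.exp (-Real.log x) = x⁻¹ := fun x hx => by
    rw [Real.exp_neg, Real.exp_log hx]
  rw [hexp _ (by positivity)] at b₁ b₂
  have b₃' : μ.real (⋃ B ∈ t, F₃ B) ≤ η / 4 := by
    refine (measureReal_biUnion_finset_le _ _).trans ((Finset.sum_le_sum b₃).trans_eq ?_)
    rw [Finset.sum_const, hexp _ (by positivity), nsmul_eq_mul]
    field_simp
  refine ⟨(F₁ ∪ F₂ ∪ ⋃ B ∈ t, F₃ B)ᶜ, ((m₁.union m₂).union m₃').compl, ?_, ?_⟩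
  · rw [probReal_compl_eq_one_sub ((m₁.union m₂).union m₃')]
    have h1 := measureReal_union_le (μ := μ) (F₁ ∪ F₂) (⋃ B ∈ t, F₃ B)
    have h2 := measureReal_union_le (μ := μ) F₁ F₂
    have h3 : (2 / η)⁻¹ + (4 / η)⁻¹ + η / 4 = η := by field_simp; norm_num
    have h4 : μ.real F₁ ≤ (2 / η)⁻¹ := b₁
    have h5 : μ.real F₂ ≤ (4 / η)⁻¹ := b₂
    linarith
  · intro ω hω Q hQ hmin
    simp only [Set.mem_compl_iff, Set.mem_union, not_or, Set.mem_iUnion, not_exists] at hω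
    obtain ⟨⟨h1, h2⟩, h3⟩ := hω
    obtain ⟨B, hB, hQB⟩ := htC Q hQ
    have h3 := h3 B hB
    simp only [hF₁, hF₂, hF₃, Set.mem_ofPred_eq, not_le, Finset.sum_neg_distrib, integral_neg] at h1 h2 h3
    have s1 : R Q ≤ R B + ε * w := by
      have h4 := abs_integral_loss_sub_le (μ := μ) hL hℓ (hX.measurable 0) (hX.measurable 1)
        (hXi 0) (hXi 1) Q B
      have h5 : ‖Q - B‖ * w ≤ ε * w :=
        mul_le_mul_of_nonneg_right hQB (integral_nonneg fun ω => norm_nonneg _)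
      have := (abs_le.1 h4).2
      simp only [hR]
      linarith
    have s2 : ∑ i ∈ Finset.range N, ℓ (X (i + 1) ω - B (X i ω)) ≤
        ∑ i ∈ Finset.range N, ℓ (X (i + 1) ω - Q (X i ω)) +
          ε * ∑ i ∈ Finset.range N, ‖X i ω‖ := by
      rw [Finset.mul_sum, ← Finset.sum_add_distrib]
      refine Finset.sum_le_sum fun i _ => ?_
      have h4 := (abs_le.1 (abs_loss_sub_le hL hℓ Q B (X i ω) (X (i + 1) ω))).1
      have h5 : ‖Q - B‖ * ‖X i ω‖ ≤ ε * ‖X i ω‖ := by gcongr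
      linarith
    have s3 := hmin Q₀ hQ₀
    have s4 := mul_le_mul_of_nonneg_left h1.le hε
    have hlog : Real.log (4 * t.card / η) = Real.log t.card + Real.log (4 / η) := by
      rw [← Real.log_mul (by positivity) (by positivity)]; ring_nf
    rw [hlog] at h3
    have s5 := mul_le_mul_of_nonneg_left hwle hε
    have key : N * R Q ≤ N * (R Q₀
        + (1 + ρ) * √M * (V₀ ρ c d * u + Real.log t.card / (u * N))
        + 2 * (1 + ρ) * Real.log (4 / η) * (√M / (u * N))
        + ε * √M * (4 * d * c / (1 - ρ) + V₀ ρ c d / (4 * δ₀ ρ c)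
          + 2 * δ₀ ρ c * Real.log (2 / η) / N)) := by
      have e1 : N * R Q ≤ N * R B + N * (ε * w) := by nlinarith
      have e2 : N * (ε * w) ≤ N * (ε * (√M * (2 * d * c / (1 - ρ)))) := by gcongr
      have e3 : (N : ℝ) * (R Q₀
        + (1 + ρ) * √M * (V₀ ρ c d * u + Real.log t.card / (u * N))
        + 2 * (1 + ρ) * Real.log (4 / η) * (√M / (u * N))
        + ε * √M * (4 * d * c / (1 - ρ) + V₀ ρ c d / (4 * δ₀ ρ c)
          + 2 * δ₀ ρ c * Real.log (2 / η) / N)) = N * R Q₀ +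
          (ρ + 1) * √M * (N * V₀ ρ c d * u / 2 + Real.log (4 / η) / u) +
          (ρ + 1) * √M * (N * V₀ ρ c d * u / 2 + (Real.log t.card + Real.log (4 / η)) / u) +
          2 * (N * (ε * (√M * (2 * d * c / (1 - ρ))))) +
          ε * ((1 + 0) * √M * (N * V₀ ρ c d * (1 / (2 * δ₀ ρ c)) / 2 +
            Real.log (2 / η) / (1 / (2 * δ₀ ρ c)))) := by
        field_simp
        ring
      rw [e3]
      rw [mul_add ε] at s4
      have e4 : ε * (N * w) = N * (ε * w) := by ring
      rw [e4] at s4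
      simp only [hR] at *
      linarith
    exact le_of_mul_le_mul_left key hN'

end Oracle

end LowRankVAR

/-! ### Assembly of the theorem. -/

theorem theorem1 {Ω : Type*} [MeasurableSpace Ω] (μ : Measure Ω) [IsProbabilityMeasure μ]
    (M n r r₀ : ℕ) (ρ c d : ℝ) (L : ℝ≥0)
    (A : Matrix (Fin M) (Fin M) ℝ) (X ξ : ℕ → Ω → EuclideanSpace ℝ (Fin M))
    (ℓ : EuclideanSpace ℝ (Fin M) → ℝ)
    -- the model
    (hX : LowRankVAR.IsStationaryVAR μ A X ξ)
    (hρ : ρ < 1) (hr₀ : 1 ≤ r₀ ∧ r₀ ≤ M) (hA : A ∈ LowRankVAR.matClass M ρ r₀)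
    -- sub-exponential noise coordinates
    (hc : 0 < c) (hd : 0 < d)
    (hξ : ∀ t j, Integrable (fun ω => Real.exp (|ξ t ω j| / c)) μ ∧
      ∫ ω, Real.exp (|ξ t ω j| / c) ∂μ ≤ d)
    -- Lipschitz loss
    (hL : L ≤ 1) (hℓ : LipschitzWith L ℓ)
    -- the rank of the estimator, and `n` large enough
    (hr : 1 ≤ r ∧ r ≤ M)
    (hn : 1 + 16 * LowRankVAR.δ₀ ρ c ^ 2 * M * r * Real.log (9 * r * n) / LowRankVAR.V₀ ρ c d
      ≤ (n : ℝ)) :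
    -- the generalization error is well defined and does not depend on the time
    (∀ Q : Matrix (Fin M) (Fin M) ℝ, ∀ t, 2 ≤ t →
      Integrable (fun ω => ℓ (X t ω - LowRankVAR.act Q (X (t - 1) ω))) μ ∧
      ∫ ω, ℓ (X t ω - LowRankVAR.act Q (X (t - 1) ω)) ∂μ = LowRankVAR.genError μ ℓ X Q) ∧
    -- the estimator exists
    (∀ ω, ∃ Ahat, LowRankVAR.IsFixedRankEstimator n ℓ ρ r (fun t => X t ω) Ahat) ∧
    -- the minimum of the generalization error exists, and the risk bound holds
    ∃ Rmin : ℝ, IsLeast (LowRankVAR.genError μ ℓ X '' LowRankVAR.matClass M ρ r) Rmin ∧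
      ∀ η : ℝ, 0 < η →
        ∃ E : Set Ω, MeasurableSet E ∧ 1 - η ≤ μ.real E ∧
          ∀ ω ∈ E, ∀ Ahat, LowRankVAR.IsFixedRankEstimator n ℓ ρ r (fun t => X t ω) Ahat →
            LowRankVAR.genError μ ℓ X Ahat ≤
              Rmin
              + 4 * (1 + ρ) * √(4 * LowRankVAR.V₀ ρ c d * M ^ 2 * r * Real.log (9 * r * n)
                  / (n - 1))
              + 2 * (1 + ρ) * Real.log (4 / η)
                  * √(LowRankVAR.V₀ ρ c d / (4 * (n - 1) * r * Real.log (9 * r * n)))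
              + √M / n * (3 * Real.exp 1 * d * c / (1 - ρ)
                  + LowRankVAR.V₀ ρ c d / (2 * LowRankVAR.δ₀ ρ c))
              + 2 * LowRankVAR.δ₀ ρ c * √M / (n * (n - 1)) * Real.log (2 / η) := by

  obtain ⟨hAr, hAρ'⟩ := hA
  have hAρ : ‖LowRankVAR.act A‖ ≤ ρ := by rwa [← LowRankVAR.schattenInf_eq_opNorm]
  have hρ0 : 0 ≤ ρ := (norm_nonneg _).trans hAρ
  have h0 : 0 < 1 - ρ := by linarith
  have hM : 1 ≤ M := hr.1.trans hr.2
  have hV := LowRankVAR.V₀_pos hc hd hρ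
  have hδ := LowRankVAR.δ₀_pos hc hρ
  have hM' : 0 < √(M : ℝ) := Real.sqrt_pos.2 (by exact_mod_cast hM)
  have hn1 : 1 ≤ n := by
    rcases Nat.eq_zero_or_pos n with h | h
    -- For `n = 0` the convention `log 0 = 0` reduces the sample-size condition to `1 ≤ 0`.
    · subst h; norm_num at hn
    · exact h
  have hn2 : 2 ≤ n := by
    by_contra hlt
    have h1 : n = 1 := by omega
    subst h1
    have hr' : (1 : ℝ) ≤ r := by exact_mod_cast hr.1
    have hΛ : 0 < Real.log (9 * r * (1 : ℕ)) := Real.log_pos (by push_cast; linarith)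
    have : 0 < 16 * LowRankVAR.δ₀ ρ c ^ 2 * M * r * Real.log (9 * r * (1 : ℕ)) /
        LowRankVAR.V₀ ρ c d := by positivity
    push_cast at hn this
    linarith
  have hAR := hX.isAR
  have hprob : IsProbabilityMeasure (μ.map (ξ 0)) :=
    Measure.isProbabilityMeasure_map (hX.measurable_noise 0).aemeasurable
  have hν : LowRankVAR.HasExpMoment (μ.map (ξ 0)) (c * √M) (2 * d) := by
    have h1 := LowRankVAR.integrable_exp_norm_div_sqrt hM hc (hX.measurable_noise 0) (hξ 0)
    have hm : AEStronglyMeasurable (fun z : EuclideanSpace ℝ (Fin M) =>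
        Real.exp (‖z‖ / (c * √M))) (μ.map (ξ 0)) := by fun_prop
    refine ⟨(integrable_map_measure hm (hX.measurable_noise 0).aemeasurable).2 h1.1, ?_⟩
    rw [integral_map (hX.measurable_noise 0).aemeasurable hm]
    exact h1.2
  have hX0 := (hAR.integrable_norm (hν.integrable_norm (by positivity)) hAρ hρ0 hρ).1
  have hXi := hAR.integrable_norm_all hX0
  have hne : (LowRankVAR.matClass M ρ r).Nonempty :=
    ⟨0, by simp [LowRankVAR.matClass, LowRankVAR.schattenInf_eq_opNorm, LowRankVAR.act, hρ0]⟩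
  refine ⟨fun Q t ht => ?_, fun ω => ?_, ?_⟩
  · obtain ⟨k, rfl⟩ : ∃ k, t = k + 2 := ⟨t - 2, by omega⟩
    have hlip := LowRankVAR.lipCost_loss hL hℓ (le_refl ‖LowRankVAR.act Q‖)
    exact ⟨hlip.integrable_comp (hAR.measurable k) (hAR.measurable (k + 1)) (hXi k) (hXi (k + 1)),
      hAR.integral_shift hlip k⟩
  · have hcont : Continuous fun B : EuclideanSpace ℝ (Fin M) →L[ℝ] EuclideanSpace ℝ (Fin M) =>
        1 / ((n : ℝ) - 1) * ∑ i ∈ Finset.Icc 2 n, ℓ (X i ω - B (X (i - 1) ω)) := by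
      have := hℓ.continuous
      fun_prop
    obtain ⟨Q, hQ, hmin⟩ := LowRankVAR.exists_isMinOn_matClass hne hcont
    exact ⟨Q, hQ, hmin⟩
  · obtain ⟨Q₀, hQ₀, hmin⟩ := LowRankVAR.exists_isMinOn_matClass hne
      (LowRankVAR.continuous_integral_loss (μ := μ) hL hℓ (hAR.measurable 0) (hAR.measurable 1)
        (hXi 0) (hXi 1))
    refine ⟨LowRankVAR.genError μ ℓ X Q₀, ⟨⟨Q₀, hQ₀, rfl⟩, ?_⟩, fun η hη => ?_⟩
    · rintro _ ⟨Q, hQ, rfl⟩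
      exact hmin Q hQ
    rcases le_or_gt 1 η with hη1 | hη1
    · exact ⟨∅, MeasurableSet.empty, by simpa using hη1, fun ω hω => absurd hω (by simp)⟩
    have hlog : 0 ≤ Real.log (4 / η) :=
      Real.log_nonneg (by rw [le_div_iff₀ hη]; linarith)
    have hn' : (1 : ℝ) ≤ n := by exact_mod_cast hn1
    -- Radius `1 / (2 n)` for each factor puts the net within `1 / n` of the class, making the
    -- discretization error of order `√M / n`.
    obtain ⟨t, ht, htc, htn⟩ := LowRankVAR.exists_finset_net_matClass (M := M) (r := r) hρ0 hρ.le
      (ε := 1 / (2 * n)) (by positivity)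
    obtain ⟨u, hu, hu1, hest, hconf⟩ :=
      LowRankVAR.exists_laplace_parameter hM hr.1 hc hd hρ hn1 hn
    have hNcast : ((n - 1 : ℕ) : ℝ) = (n : ℝ) - 1 := by rw [Nat.cast_sub hn1, Nat.cast_one]
    have hNpos : 0 < (n : ℝ) - 1 := by
      have : (2 : ℝ) ≤ n := by exact_mod_cast hn2
      linarith
    have hQ₀ρ : ‖LowRankVAR.act Q₀‖ ≤ ρ := by
      rw [← LowRankVAR.schattenInf_eq_opNorm]; exact hQ₀.2
    obtain ⟨E, hE, hEη, hbound⟩ := LowRankVAR.exists_event_risk_le hAR hM hc hd hν hAρ hρ0 hρ hL hℓ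
      hη (N := n - 1) (by omega) (C := LowRankVAR.act '' LowRankVAR.matClass M ρ r)
      ⟨Q₀, hQ₀, rfl⟩ hQ₀ρ (t := t) (ε := 1 / n) (by positivity) ht
      (by
        rintro _ ⟨Q, hQ, rfl⟩
        obtain ⟨B, hB, hQB⟩ := htc Q hQ
        exact ⟨B, hB, hQB.trans_eq (by field_simp)⟩) hu hu1
    refine ⟨E, hE, hEη, fun ω hω Â hÂ => ?_⟩
    have hb := hbound ω hω (LowRankVAR.act Â) ⟨Â, hÂ.1, rfl⟩ (by
      rintro _ ⟨Q, hQ, rfl⟩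
      have h1 := hÂ.2 Q hQ
      rw [LowRankVAR.empError_eq_sum_range hn1, LowRankVAR.empError_eq_sum_range hn1, hNcast] at h1
      exact le_of_mul_le_mul_left h1 (by positivity))
    have hT : (0 : ℝ) < t.card := by
      obtain ⟨B, hB, -⟩ := htc Q₀ hQ₀
      exact_mod_cast Finset.card_pos.2 ⟨B, hB⟩
    have hcard := LowRankVAR.log_card_net_le hT hr.1 hn1 htn
    rw [hNcast, hconf] at hb
    refine hb.trans ?_
    have he : 2 ≤ Real.exp 1 := by have := Real.add_one_le_exp (1 : ℝ); linarith
    change _ ≤ ∫ ω, ℓ (X 2 ω - LowRankVAR.act Q₀ (X 1 ω)) ∂μ + _ + _ + _ + _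
    have t1 : (1 + ρ) * √M * (LowRankVAR.V₀ ρ c d * u + Real.log t.card / (u * ((n : ℝ) - 1))) ≤
        4 * (1 + ρ) * √(4 * LowRankVAR.V₀ ρ c d * M ^ 2 * r * Real.log (9 * r * n) / (n - 1)) := by
      calc _ ≤ (1 + ρ) * (√M * (LowRankVAR.V₀ ρ c d * u +
            2 * (M * r) * Real.log (9 * r * n) / (u * ((n : ℝ) - 1)))) := by
            rw [mul_assoc]; gcongr
        _ ≤ (1 + ρ) * (4 * √(4 * LowRankVAR.V₀ ρ c d * M ^ 2 * r *
            Real.log (9 * r * n) / (n - 1))) := by gcongr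
        _ = _ := by ring
    have t2 : 1 / (n : ℝ) * √M * (4 * d * c / (1 - ρ) + LowRankVAR.V₀ ρ c d / (4 * LowRankVAR.δ₀ ρ c)
          + 2 * LowRankVAR.δ₀ ρ c * Real.log (2 / η) / ((n : ℝ) - 1)) ≤
        √M / n * (3 * Real.exp 1 * d * c / (1 - ρ) +
          LowRankVAR.V₀ ρ c d / (2 * LowRankVAR.δ₀ ρ c)) +
        2 * LowRankVAR.δ₀ ρ c * √M / (n * (n - 1)) * Real.log (2 / η) := by
      have e1 : 4 * d * c / (1 - ρ) ≤ 3 * Real.exp 1 * d * c / (1 - ρ) := by gcongr; linarith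
      have e2 : LowRankVAR.V₀ ρ c d / (4 * LowRankVAR.δ₀ ρ c) ≤
          LowRankVAR.V₀ ρ c d / (2 * LowRankVAR.δ₀ ρ c) := by gcongr; norm_num
      calc _ = √M / n * (4 * d * c / (1 - ρ) + LowRankVAR.V₀ ρ c d / (4 * LowRankVAR.δ₀ ρ c)) +
            2 * LowRankVAR.δ₀ ρ c * √M / (n * (n - 1)) * Real.log (2 / η) := by field_simp
        _ ≤ _ := by gcongr
    linarith
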